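/- **Theorem 2.1 (special coordinates).** Let $\Omega=\{w\in\mathbb C^3 : R(w)<0\}$ be a smoothly bounded (Levi) pseudoconvex domain with $C^\infty$ defining function $R$ ($dR\neq 0$ on $b\Omega$), and let $0\in b\Omega$. Let $T_{BG}(0)=m<\infty$, where $T_{BG}(0)$ is the Bloom–Graham type, i.e. the maximal order of vanishing at $0$ of $R\circ\varphi$ over all germs at $0$ of holomorphic maps $\varphi:\mathbb C^2\to\mathbb C^3$ with $\varphi(0)=0$ and $d\varphi(0)$ injective (the maximal order of contact of $b\Omega$ with smooth $2$-dimensional complex submanifolds). Let $V$ be a smooth $1$-dimensional complex analytic variety through $0$, and let $\eta\ge m$ be an integer such that, for some constant $C$, $|R(w)|\le C|w|^\eta$ for all $w\in V$ sufficiently close to $0$. Then there are a holomorphic coordinate system $z=(z_1,z_2,z_3)$ about $0$, $w=\Psi(z)$ with $\Psi(0)=0$, and complex numbers $a_{\alpha,\beta}$ such that, with $z'=(z_1,z_2)$ and $r=R\circ\Psi$: (i) as $z\to0$, $$r(z)=\operatorname{Re} z_3+\sum_{\substack{m\le|\alpha|+|\beta|\le\eta\\ |\alpha|>0,\ |\beta|>0}}a_{\alpha,\beta}\,z'^{\alpha}\bar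 z'^{\beta}+O\big(|z_3||z|+|z'|^{\eta+1}\big);$$ (ii) in these coordinates $V$ is the $z_1$-axis to order $\eta$: near $0$ it is given by $z_2=0$, $z_3=g(z_1)$ for some $g$ holomorphic near $0$ with $g(t)=O(|t|^\eta)$; moreover $|r(t,0,0)|\lesssim|t|^\eta$ as $t\to 0$ in $\mathbb C$; (iii) $a_{\alpha,\beta}\neq0$ for some $\alpha=(0,\alpha_2)$, $\beta=(0,\beta_2)$ with $\alpha_2+\beta_2=m$, $\alpha_2>0$, $\beta_2>0$. -/

import Mathlib

open scoped Topology ContDiff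

/-- Order of vanishing at the origin of a real function `g`, as an element of `ℕ∞`:
the supremum of all `k` with `g(x) = O(‖x‖ ^ k)` as `x → 0`. For a smooth `g` this is the lowest
degree of a nonzero term of the Taylor expansion of `g` at `0` (and `⊤` if all of them vanish). -/
noncomputable def vanishingOrder {E : Type*} [NormedAddCommGroup E] (g : E → ℝ) : ℕ∞ :=
  ⨆ (k : ℕ) (_ : g =O[𝓝 0] fun x => ‖x‖ ^ k), (k : ℕ∞)

/-- `φ` parametrizes, near the parameter value `0`, a smooth complex submanifold germ through `p`:
it is holomorphic near `0`, maps `0` to `p`, and its complex derivative at `0` is injective. -/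
structure IsSubmanifoldParam {E F : Type*} [NormedAddCommGroup E] [NormedSpace ℂ E]
    [NormedAddCommGroup F] [NormedSpace ℂ F] (φ : E → F) (p : F) : Prop where
  analyticAt : AnalyticAt ℂ φ 0
  map_zero : φ 0 = p
  injective_fderiv : Function.Injective (fderiv ℂ φ 0)

/-- The Bloom-Graham type at `p ∈ ℂ ^ (n + 1)` of the hypersurface with defining function `R`:
the maximal order of contact at `p` with smooth complex submanifolds of dimension `n`. -/
noncomputable def bloomGrahamType {n : ℕ} (R : EuclideanSpace ℂ (Fin (n + 1)) → ℝ)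
    (p : EuclideanSpace ℂ (Fin (n + 1))) : ℕ∞ :=
  ⨆ (φ : EuclideanSpace ℂ (Fin n) → EuclideanSpace ℂ (Fin (n + 1)))
    (_ : IsSubmanifoldParam φ p), vanishingOrder (fun ζ => R (φ ζ))

/-- `V` is, near `p`, a smooth one-dimensional complex analytic variety through `p`: some
holomorphic `γ` with `γ 0 = p`, `γ' 0 ≠ 0` (injectivity of the derivative) parametrizes `V` near
`p`; the equality of filters says that the images under `γ` of the small neighbourhoods of `0` are
exactly the small neighbourhoods of `p` in `V`. -/
def IsSmoothCurveAt {n : ℕ} (V : Set (EuclideanSpace ℂ (Fin n)))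
    (p : EuclideanSpace ℂ (Fin n)) : Prop :=
  ∃ γ : ℂ → EuclideanSpace ℂ (Fin n),
    IsSubmanifoldParam γ p ∧ Filter.map γ (𝓝 0) = 𝓝[V] p

/-- `Ω` is a smoothly bounded domain with the smooth defining function `R`. -/
structure IsSmoothlyBoundedDomain {n : ℕ} (Ω : Set (EuclideanSpace ℂ (Fin n)))
    (R : EuclideanSpace ℂ (Fin n) → ℝ) : Prop where
  eq_sublevel : Ω = {w | R w < 0}
  isConnected : IsConnected Ω
  isBounded : Bornology.IsBounded Ω
  contDiff : ContDiff ℝ ∞ R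
  fderiv_ne_zero : ∀ p ∈ frontier Ω, fderiv ℝ R p ≠ 0

/-- The Levi form `∑ (∂²R / ∂w_j ∂w̄_k)(p) ξ_j ξ̄_k`, written through the real second derivative. -/
noncomputable def leviForm {n : ℕ} (R : EuclideanSpace ℂ (Fin n) → ℝ)
    (p ξ : EuclideanSpace ℂ (Fin n)) : ℝ :=
  (1 / 4) * (fderiv ℝ (fderiv ℝ R) p ξ ξ +
    fderiv ℝ (fderiv ℝ R) p (Complex.I • ξ) (Complex.I • ξ))

/-- (Levi) pseudoconvexity of `Ω` with defining function `R`: at every boundary point the Levi form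
is nonnegative on complex tangent vectors, that is, on the `ξ` with `∑ (∂R / ∂w_j)(p) ξ_j = 0`
(equivalently, both `ξ` and `i ξ` are tangent to the boundary). -/
def IsLeviPseudoconvex {n : ℕ} (Ω : Set (EuclideanSpace ℂ (Fin n)))
    (R : EuclideanSpace ℂ (Fin n) → ℝ) : Prop :=
  ∀ p ∈ frontier Ω, ∀ ξ : EuclideanSpace ℂ (Fin n),
    fderiv ℝ R p ξ = 0 → fderiv ℝ R p (Complex.I • ξ) = 0 → 0 ≤ leviForm R p ξ

/-- `w = Ψ z` is a holomorphic coordinate system about the origin: `Ψ` is holomorphic near `0`, fixes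
`0`, and has an invertible complex derivative at `0`. -/
structure IsHolomorphicCoordinates {n : ℕ}
    (Ψ : EuclideanSpace ℂ (Fin n) → EuclideanSpace ℂ (Fin n)) : Prop where
  analyticAt : AnalyticAt ℂ Ψ 0
  map_zero : Ψ 0 = 0
  bijective_fderiv : Function.Bijective (fderiv ℂ Ψ 0)

/-- `z' = (z₁, z₂)` for `z = (z₁, z₂, z₃)`. -/
noncomputable def firstTwo (z : EuclideanSpace ℂ (Fin 3)) : EuclideanSpace ℂ (Fin 2) :=
  !₂[z 0, z 1]

/-- The length `|α| = α₁ + α₂` of a multi-index. -/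
def multiLength (α : Fin 2 → ℕ) : ℕ := ∑ i, α i

/-- The monomial `u ^ α * ū ^ β` for `u ∈ ℂ²`. -/
noncomputable def mixedMonomial (α β : Fin 2 → ℕ) (u : EuclideanSpace ℂ (Fin 2)) : ℂ :=
  (∏ i, u i ^ α i) * ∏ i, (starRingEnd ℂ (u i)) ^ β i

/-- The pairs `(α, β)` of multi-indices with `|α|, |β| > 0` and `m ≤ |α| + |β| ≤ η`. -/
def mixedIndices (m η : ℕ) : Finset ((Fin 2 → ℕ) × (Fin 2 → ℕ)) :=
  ((Fintype.piFinset fun _ => Finset.range (η + 1)) ×ˢ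
    (Fintype.piFinset fun _ => Finset.range (η + 1))).filter fun x =>
      0 < multiLength x.1 ∧ 0 < multiLength x.2 ∧
        m ≤ multiLength x.1 + multiLength x.2 ∧ multiLength x.1 + multiLength x.2 ≤ η

theorem mem_mixedIndices (m η : ℕ) (x : (Fin 2 → ℕ) × (Fin 2 → ℕ)) :
    x ∈ mixedIndices m η ↔ 0 < multiLength x.1 ∧ 0 < multiLength x.2 ∧
      m ≤ multiLength x.1 + multiLength x.2 ∧ multiLength x.1 + multiLength x.2 ≤ η := by
  simp only [mixedIndices, multiLength, Finset.mem_filter, Finset.mem_product,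
    Fintype.mem_piFinset, Finset.mem_range, Fin.sum_univ_two, Fin.forall_fin_two]
  omega

open Finset.HasAntidiagonal

/-! Choose coordinates `(u, s)` with `u ∈ ℂ²` in which `V` is tangent to the `u₁`-axis and `dR(0) =
Re s`, then absorb the pure (holomorphic and antiholomorphic) Taylor terms of `R` on `s = 0` into
`s`, degree by degree (`exists_graph_without_pure_terms`). This leaves `r = Re s + (mixed terms in
u) + O(|s||(u, s)|)` up to the chosen order.

The engine is `re_cancellation`. If `Re h`, with `h` holomorphic in one variable and `h(0) = 0`,
plus a polynomial in `z, z̄` without terms `z ^ p`, plus an error `O(|z||h|)`, vanishes to order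
`n`, then no cancellation is possible: `h` and the polynomial both vanish to order `n`. Hence a
curve of high contact has a small `s`-component, and the mixed terms are small along its
`u`-component.

For `V` this gives the order `η` of `g` and of `r` on the axis (`isBigO_of_contact`). For a surface
of contact `m`, cut by the images of complex lines, it kills every component of degree below `m`
(`eq_zero_of_lt`). Some component of degree `m` survives, since otherwise `s = 0` would have contact
`m + 1` (`exists_ne_zero`). A shear fixing the `u₁`-axis then moves a direction where this component
is nonzero to the `z₂`-axis. -/

/-! ### Taylor's formula and polynomials in `u, ū` on `ℂ²` -/

theorem isBigO_sub_taylor {E F : Type*} [NormedAddCommGroup E] [NormedSpace ℝ E]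
    [NormedAddCommGroup F] [NormedSpace ℝ F] [CompleteSpace F] {f : E → F} {n : ℕ}
    (hf : ContDiffAt ℝ (n + 1) f 0) :
    (fun x => f x - ∑ k ∈ Finset.range (n + 1),
      (k.factorial : ℝ)⁻¹ • iteratedFDeriv ℝ k f 0 (fun _ => x)) =O[𝓝 0]
        fun x => ‖x‖ ^ (n + 1) := by
  have h1 : ∀ᶠ y in 𝓝 (0 : E), ContDiffAt ℝ (n + 1) f y :=
    hf.eventually (by exact_mod_cast (WithTop.coe_ne_top))
  have hc : ContinuousAt (iteratedFDeriv ℝ (n + 1) f) 0 :=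
    (hf.iteratedFDeriv_right (i := n + 1) (m := 0) (by simp)).continuousAt
  have h2 : ∀ᶠ y in 𝓝 (0 : E), ‖iteratedFDeriv ℝ (n + 1) f y‖ < ‖iteratedFDeriv ℝ (n + 1) f 0‖ + 1 :=
    hc.norm.eventually_lt continuousAt_const (by simp)
  obtain ⟨δ, hδ, hb⟩ := Metric.eventually_nhds_iff_ball.1 (h1.and h2)
  refine Asymptotics.IsBigO.of_bound ((n.factorial : ℝ)⁻¹ * (‖iteratedFDeriv ℝ (n + 1) f 0‖ + 1)) ?_
  filter_upwards [Metric.ball_mem_nhds (0 : E) hδ] with x hx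
  have hmem : ∀ t ∈ Set.Icc (0 : ℝ) 1, (0 : E) + t • x ∈ Metric.ball (0 : E) δ := by
    intro t ht
    rw [mem_ball_zero_iff] at hx ⊢
    rw [zero_add, norm_smul, Real.norm_of_nonneg ht.1]
    exact (mul_le_of_le_one_left (norm_nonneg _) ht.2).trans_lt hx
  have key := map_add_eq_sum_add_integral_iteratedFDeriv (f := f) (x := 0) (y := x) (n := n)
    fun t ht => (hb _ (hmem t ht)).1
  rw [zero_add] at key
  rw [key, add_sub_cancel_left, norm_smul, norm_pow, norm_norm, mul_assoc,
    Real.norm_of_nonneg (by positivity)]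
  gcongr
  refine (intervalIntegral.norm_integral_le_of_norm_le_const
    (C := (‖iteratedFDeriv ℝ (n + 1) f 0‖ + 1) * ‖x‖ ^ (n + 1)) ?_).trans (by simp)
  intro t ht
  rw [Set.uIoc_of_le zero_le_one] at ht
  have ht' : t ∈ Set.Icc (0 : ℝ) 1 := ⟨ht.1.le, ht.2⟩
  rw [norm_smul, norm_pow, Real.norm_of_nonneg (by linarith [ht.2])]
  have h3 := (iteratedFDeriv ℝ (n + 1) f (0 + t • x)).le_opNorm fun _ => x
  rw [Finset.prod_const, Finset.card_univ, Fintype.card_fin] at h3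
  calc (1 - t) ^ n * ‖iteratedFDeriv ℝ (n + 1) f (0 + t • x) fun _ => x‖
      ≤ 1 * (‖iteratedFDeriv ℝ (n + 1) f (0 + t • x)‖ * ‖x‖ ^ (n + 1)) := by
        gcongr
        exact pow_le_one₀ (by linarith [ht.2]) (by linarith [ht.1])
    _ ≤ _ := by
        rw [one_mul]
        gcongr
        exact (hb _ (hmem t ht')).2.le

/-- The span of the monomials `u ^ α * ū ^ β` with `|α| = p` and `|β| = q`. -/
noncomputable def bihomogeneous (p q : ℕ) : Submodule ℂ (EuclideanSpace ℂ (Fin 2) → ℂ) :=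
  Submodule.span ℂ ((fun x : (Fin 2 → ℕ) × (Fin 2 → ℕ) => mixedMonomial x.1 x.2) ''
    {x | multiLength x.1 = p ∧ multiLength x.2 = q})

theorem mixedMonomial_smul (α β : Fin 2 → ℕ) (c : ℂ) (u : EuclideanSpace ℂ (Fin 2)) :
    mixedMonomial α β (c • u) =
      c ^ multiLength α * (starRingEnd ℂ c) ^ multiLength β * mixedMonomial α β u := by
  simp only [mixedMonomial, multiLength, Fin.prod_univ_two, Fin.sum_univ_two, PiLp.smul_apply,
    smul_eq_mul, map_mul, mul_pow, pow_add]
  ring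

theorem bihomogeneous_smul {p q : ℕ} {F : EuclideanSpace ℂ (Fin 2) → ℂ}
    (hF : F ∈ bihomogeneous p q) (c : ℂ) (u : EuclideanSpace ℂ (Fin 2)) :
    F (c • u) = c ^ p * (starRingEnd ℂ c) ^ q * F u := by
  induction hF using Submodule.span_induction with
  | mem F hF =>
    obtain ⟨x, ⟨h1, h2⟩, rfl⟩ := hF
    simp only [mixedMonomial_smul, h1, h2]
  | zero => simp
  | add F G _ _ hF hG => simp only [Pi.add_apply, hF, hG]; ring
  | smul a F _ hF => simp only [Pi.smul_apply, hF, smul_eq_mul]; ring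

theorem contDiff_mixedMonomial (α β : Fin 2 → ℕ) : ContDiff ℝ ∞ (mixedMonomial α β) := by
  have h (i : Fin 2) : ContDiff ℝ ∞ fun u : EuclideanSpace ℂ (Fin 2) => u i :=
    (contDiff_euclidean (𝕜 := ℂ) (n := ∞) |>.1 contDiff_id i).restrict_scalars ℝ
  have h' (i : Fin 2) : ContDiff ℝ ∞ fun u : EuclideanSpace ℂ (Fin 2) => starRingEnd ℂ (u i) :=
    Complex.conjCLE.contDiff.comp (h i)
  unfold mixedMonomial
  exact (contDiff_prod fun i _ => (h i).pow _).mul (contDiff_prod fun i _ => (h' i).pow _)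

theorem contDiff_of_mem_bihomogeneous {p q : ℕ} {F : EuclideanSpace ℂ (Fin 2) → ℂ}
    (hF : F ∈ bihomogeneous p q) : ContDiff ℝ ∞ F := by
  induction hF using Submodule.span_induction with
  | mem F hF =>
    obtain ⟨x, -, rfl⟩ := hF
    exact contDiff_mixedMonomial _ _
  | zero => exact contDiff_const
  | add F G _ _ hF hG => exact hF.add hG
  | smul a F _ hF => exact contDiff_const.mul hF

theorem contDiff_of_mem_bihomogeneous_zero {p : ℕ} {F : EuclideanSpace ℂ (Fin 2) → ℂ}
    (hF : F ∈ bihomogeneous p 0) : ContDiff ℂ ω F := by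
  induction hF using Submodule.span_induction with
  | mem F hF =>
    obtain ⟨⟨α, β⟩, ⟨-, h2⟩, rfl⟩ := hF
    have hβ : ∀ i, β i = 0 := by
      simpa [multiLength, Fin.forall_fin_two] using h2
    have h (i : Fin 2) : ContDiff ℂ ω fun u : EuclideanSpace ℂ (Fin 2) => u i :=
      (contDiff_euclidean (𝕜 := ℂ) (n := ω) |>.1 contDiff_id i)
    have : mixedMonomial α β = fun u => ∏ i, u i ^ α i := by
      ext u; simp [mixedMonomial, hβ]
    simp only [this]
    exact contDiff_prod fun i _ => (h i).pow _
  | zero => exact contDiff_const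
  | add F G _ _ hF hG => exact hF.add hG
  | smul a F _ hF => exact contDiff_const.mul hF

theorem isBigO_of_mem_bihomogeneous {p q : ℕ} {F : EuclideanSpace ℂ (Fin 2) → ℂ}
    (hF : F ∈ bihomogeneous p q) : F =O[𝓝 0] fun u => ‖u‖ ^ (p + q) := by
  induction hF using Submodule.span_induction with
  | mem F hF =>
    obtain ⟨⟨α, β⟩, ⟨rfl, rfl⟩, rfl⟩ := hF
    refine Asymptotics.IsBigO.of_bound 1 (Filter.Eventually.of_forall fun u => ?_)
    have h (i : Fin 2) : ‖u i‖ ≤ ‖u‖ := PiLp.norm_apply_le u i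
    simp only [mixedMonomial, multiLength, norm_mul, Fin.prod_univ_two, norm_pow, RCLike.norm_conj,
      norm_norm, one_mul, Fin.sum_univ_two, pow_add]
    gcongr <;> exact h _
  | zero => exact Asymptotics.isBigO_zero _ _
  | add F G _ _ hF hG => exact hF.add hG
  | smul a F _ hF => exact hF.const_smul_left a

/-- The span of the monomials `u ^ α * ū ^ β` with `|α| + |β| = k`. -/
noncomputable def homogeneous (k : ℕ) : Submodule ℂ (EuclideanSpace ℂ (Fin 2) → ℂ) :=
  ⨆ x ∈ antidiagonal k, bihomogeneous x.1 x.2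

theorem mixedMonomial_mem_homogeneous (α β : Fin 2 → ℕ) :
    mixedMonomial α β ∈ homogeneous (multiLength α + multiLength β) := by
  have h : mixedMonomial α β ∈ bihomogeneous (multiLength α) (multiLength β) :=
    Submodule.subset_span ⟨(α, β), ⟨rfl, rfl⟩, rfl⟩
  exact Submodule.mem_iSup_of_mem (multiLength α, multiLength β)
    (Submodule.mem_iSup_of_mem (mem_antidiagonal.2 rfl) h)

theorem homogeneous_induction {k : ℕ} {S : Submodule ℂ (EuclideanSpace ℂ (Fin 2) → ℂ)}
    (h : ∀ α β, multiLength α + multiLength β = k → mixedMonomial α β ∈ S) :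
    homogeneous k ≤ S := by
  refine iSup₂_le fun x hx => Submodule.span_le.2 ?_
  rintro _ ⟨⟨α, β⟩, ⟨h1, h2⟩, rfl⟩
  exact h α β (by rw [h1, h2]; exact mem_antidiagonal.1 hx)

theorem coord_mul_mem_homogeneous {k : ℕ} {F : EuclideanSpace ℂ (Fin 2) → ℂ}
    (hF : F ∈ homogeneous k) (i : Fin 2) : (fun u => u i * F u) ∈ homogeneous (k + 1) := by
  have : homogeneous k ≤ (homogeneous (k + 1)).comap
      (LinearMap.mulLeft ℂ (fun u : EuclideanSpace ℂ (Fin 2) => u i)) := by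
    refine homogeneous_induction fun α β h => ?_
    have h1 : multiLength (α + Pi.single i 1) + multiLength β = k + 1 := by
      rw [← h]
      fin_cases i <;> simp [multiLength] <;> ring
    have h2 := mixedMonomial_mem_homogeneous (α + Pi.single i 1) β
    rw [h1] at h2
    rw [Submodule.mem_comap]
    convert h2 using 1
    ext u
    fin_cases i <;> simp [mixedMonomial, pow_succ] <;> ring
  exact this hF

theorem conj_coord_mul_mem_homogeneous {k : ℕ} {F : EuclideanSpace ℂ (Fin 2) → ℂ}
    (hF : F ∈ homogeneous k) (i : Fin 2) :
    (fun u => starRingEnd ℂ (u i) * F u) ∈ homogeneous (k + 1) := by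
  have : homogeneous k ≤ (homogeneous (k + 1)).comap
      (LinearMap.mulLeft ℂ (fun u : EuclideanSpace ℂ (Fin 2) => starRingEnd ℂ (u i))) := by
    refine homogeneous_induction fun α β h => ?_
    have h1 : multiLength α + multiLength (β + Pi.single i 1) = k + 1 := by
      rw [← h]
      fin_cases i <;> simp [multiLength] <;> ring
    have h2 := mixedMonomial_mem_homogeneous α (β + Pi.single i 1)
    rw [h1] at h2
    rw [Submodule.mem_comap]
    convert h2 using 1
    ext u
    fin_cases i <;> simp [mixedMonomial, pow_succ] <;> ring
  exact this hF

/-- This turns real Taylor terms into polynomials in `u` and `ū`. Induction on the number of slots: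
expanding one slot in a real basis produces the factors `Re uᵢ` and `Im uᵢ`, which are combinations
of `uᵢ` and `ūᵢ`. -/
theorem multilinear_diagonal_mem_homogeneous {k : ℕ}
    (A : MultilinearMap ℝ (fun _ : Fin k => EuclideanSpace ℂ (Fin 2)) ℂ) :
    (fun u => A fun _ => u) ∈ homogeneous k := by
  induction k with
  | zero =>
    have h := (homogeneous (0 + 0)).smul_mem (A 0) (mixedMonomial_mem_homogeneous 0 0)
    convert h using 1
    ext u
    simp [mixedMonomial]
    congr 1; ext i; exact i.elim0
  | succ k ih =>
    let e (i : Fin 2) : EuclideanSpace ℂ (Fin 2) := EuclideanSpace.single i 1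
    let e' (i : Fin 2) : EuclideanSpace ℂ (Fin 2) := EuclideanSpace.single i Complex.I
    have hu (u : EuclideanSpace ℂ (Fin 2)) :
        u = ∑ i, ((u i).re • e i + (u i).im • e' i) := by
      ext j
      fin_cases j <;> simp [e, e', Complex.re_add_im]
    -- The coefficients of `uᵢ` and `ūᵢ` are the Wirtinger combinations `(A(e) ∓ i A(ie)) / 2` of
    -- the curried map.
    have hA : (fun u : EuclideanSpace ℂ (Fin 2) => A fun _ => u) = ∑ i,
        ((fun u => u i * ((1 / 2 : ℂ) • ((fun u => A.curryLeft (e i) fun _ => u)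
            - Complex.I • fun u => A.curryLeft (e' i) fun _ => u)) u) +
          fun u => starRingEnd ℂ (u i) * ((1 / 2 : ℂ) • ((fun u => A.curryLeft (e i) fun _ => u)
            + Complex.I • fun u => A.curryLeft (e' i) fun _ => u)) u) := by
      ext u
      have h1 : (A fun _ => u) = A.curryLeft u fun _ => u := by
        rw [MultilinearMap.curryLeft_apply]
        congr 1; ext1 i
        refine Fin.cases ?_ (fun j => ?_) i <;> simp
      have h2 : A.curryLeft u =
          ∑ i, ((u i).re • A.curryLeft (e i) + (u i).im • A.curryLeft (e' i)) := by
        conv_lhs => rw [hu u]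
        simp only [map_sum, map_add, map_smul]
      rw [h1, h2]
      simp only [sum_apply, add_apply, smul_apply,
        Finset.sum_apply, Pi.add_apply, Pi.smul_apply, Pi.sub_apply, smul_eq_mul,
        Complex.real_smul]
      refine Finset.sum_congr rfl fun i _ => ?_
      have hz := Complex.re_add_im (u i)
      have hz' : starRingEnd ℂ (u i) = (u i).re - (u i).im * Complex.I := by
        apply Complex.ext <;> simp
      rw [hz']
      linear_combination (1 / 2 * ((A.curryLeft (e i) fun _ => u)
        - Complex.I * A.curryLeft (e' i) fun _ => u)) * hz
        + ((u i).im * (A.curryLeft (e' i) fun _ => u) : ℂ) * Complex.I_mul_I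
    rw [hA]
    refine Submodule.sum_mem _ fun i _ => Submodule.add_mem _ ?_ ?_
    · exact coord_mul_mem_homogeneous (Submodule.smul_mem _ _ (Submodule.sub_mem _ (ih _)
        (Submodule.smul_mem _ _ (ih _)))) i
    · exact conj_coord_mul_mem_homogeneous (Submodule.smul_mem _ _ (Submodule.add_mem _ (ih _)
        (Submodule.smul_mem _ _ (ih _)))) i

/-! ### Jets by bidegree, and their uniqueness -/

/-- The sum of the components of total degree at most `n` of a family of functions. -/
noncomputable def jetSum (n : ℕ) (F : ℕ × ℕ → EuclideanSpace ℂ (Fin 2) → ℂ)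
    (u : EuclideanSpace ℂ (Fin 2)) : ℂ :=
  ∑ k ∈ Finset.range (n + 1), ∑ x ∈ antidiagonal k, F x u

/-- `F` is the family of bihomogeneous components of the Taylor polynomial of order `n` of `f` at
the origin. -/
structure IsJet (n : ℕ) (f : EuclideanSpace ℂ (Fin 2) → ℂ)
    (F : ℕ × ℕ → EuclideanSpace ℂ (Fin 2) → ℂ) : Prop where
  mem : ∀ x, F x ∈ bihomogeneous x.1 x.2
  isBigO : (fun u => f u - jetSum n F u) =O[𝓝 0] fun u => ‖u‖ ^ (n + 1)

theorem exists_isJet {f : EuclideanSpace ℂ (Fin 2) → ℂ} (hf : ContDiffAt ℝ ∞ f 0) (n : ℕ) :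
    ∃ F, IsJet n f F := by
  have h1 (k : ℕ) : ∃ μ : ∀ x : ℕ × ℕ, bihomogeneous x.1 x.2,
      ∑ x ∈ antidiagonal k, (μ x : EuclideanSpace ℂ (Fin 2) → ℂ) =
        fun u => (k.factorial : ℝ)⁻¹ • iteratedFDeriv ℝ k f 0 (fun _ => u) := by
    rw [← Submodule.mem_iSup_finset_iff_exists_sum]
    exact multilinear_diagonal_mem_homogeneous
      ((k.factorial : ℝ)⁻¹ • (iteratedFDeriv ℝ k f 0).toMultilinearMap)
  choose μ hμ using h1
  -- Each Taylor term was split separately; the component of bidegree `(p, q)` is read from the term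
  -- of degree `p + q`.
  refine ⟨fun x => μ (x.1 + x.2) x, fun x => (μ (x.1 + x.2) x).2, ?_⟩
  refine (isBigO_sub_taylor (n := n) (hf.of_le (by exact_mod_cast le_top))).congr_left fun u => ?_
  unfold jetSum
  congr 1
  refine Finset.sum_congr rfl fun k _ => ?_
  rw [← congrFun (hμ k) u, Finset.sum_apply]
  refine Finset.sum_congr rfl fun x hx => ?_
  simp only [mem_antidiagonal.1 hx]

/-- Mean value inequality on the ball of radius `‖p‖`, where the derivative differs from its value
at `0` by `O(‖p‖)`. The factor `‖p.1 - p.2‖` is essential: it becomes `|s|` in the normal form, and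
the size of the correction when pure terms are removed. -/
theorem isBigO_sub_sub_fderiv {E F : Type*} [NormedAddCommGroup E] [NormedSpace ℝ E]
    [NormedAddCommGroup F] [NormedSpace ℝ F] {r : E → F} (hr : ContDiffAt ℝ 2 r 0) :
    (fun p : E × E => r p.1 - r p.2 - fderiv ℝ r 0 (p.1 - p.2)) =O[𝓝 0]
      fun p => ‖p‖ * ‖p.1 - p.2‖ := by
  have h1 : ∀ᶠ z in 𝓝 (0 : E), DifferentiableAt ℝ r z :=
    (hr.eventually (by norm_num)).mono fun z hz => hz.differentiableAt (by norm_num)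
  have h2 : DifferentiableAt ℝ (fderiv ℝ r) 0 :=
    (hr.fderiv_right (m := 1) (by norm_num)).differentiableAt (by norm_num)
  obtain ⟨C, hC⟩ := h2.isBigO_sub.bound
  obtain ⟨δ, hδ, hb⟩ := Metric.eventually_nhds_iff_ball.1 (h1.and hC)
  refine Asymptotics.IsBigO.of_bound |C| ?_
  filter_upwards [Metric.ball_mem_nhds (0 : E × E) hδ] with p hp
  rw [mem_ball_zero_iff] at hp
  rw [norm_mul, norm_norm, norm_norm, ← mul_assoc]
  have hs : ∀ x ∈ Metric.closedBall (0 : E) ‖p‖, x ∈ Metric.ball (0 : E) δ := fun x hx =>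
    Metric.closedBall_subset_ball hp hx
  refine (convex_closedBall (0 : E) ‖p‖).norm_image_sub_le_of_norm_hasFDerivWithin_le'
    (f' := fderiv ℝ r) (fun x hx => (hb x (hs x hx)).1.hasFDerivAt.hasFDerivWithinAt)
    (fun x hx => ?_) ?_ ?_
  · refine (hb x (hs x hx)).2.trans ?_
    rw [sub_zero]
    gcongr
    · exact le_abs_self C
    · exact mem_closedBall_zero_iff.1 hx
  · exact mem_closedBall_zero_iff.2 (norm_snd_le p)
  · exact mem_closedBall_zero_iff.2 (norm_fst_le p)

theorem eq_zero_of_homogeneous_of_isBigO {E : Type*} [NormedAddCommGroup E] [NormedSpace ℝ E]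
    {S : E → ℂ} {d : ℕ} (hS : ∀ (t : ℝ) (u : E), S (t • u) = (t : ℂ) ^ d * S u)
    (hO : S =O[𝓝 0] fun u => ‖u‖ ^ (d + 1)) (u : E) : S u = 0 := by
  obtain ⟨C, hC⟩ := hO.bound
  have h1 : Filter.Tendsto (fun t : ℝ => t • u) (𝓝[>] 0) (𝓝 0) := by
    have : Filter.Tendsto (fun t : ℝ => t • u) (𝓝 0) (𝓝 ((0 : ℝ) • u)) :=
      Continuous.tendsto (by fun_prop) 0
    rw [zero_smul] at this
    exact this.mono_left nhdsWithin_le_nhds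
  have h2 : ∀ᶠ t : ℝ in 𝓝[>] 0, ‖S u‖ ≤ C * ‖u‖ ^ (d + 1) * t := by
    filter_upwards [h1.eventually hC, self_mem_nhdsWithin] with t ht ht0
    have ht0 : 0 < t := ht0
    rw [hS, norm_mul, norm_pow, norm_pow, norm_norm, norm_smul, Complex.norm_real,
      Real.norm_of_nonneg ht0.le] at ht
    have : t ^ d * ‖S u‖ ≤ t ^ d * (C * ‖u‖ ^ (d + 1) * t) := ht.trans_eq (by ring)
    exact le_of_mul_le_mul_left this (by positivity)
  have h3 : Filter.Tendsto (fun t : ℝ => C * ‖u‖ ^ (d + 1) * t) (𝓝[>] 0) (𝓝 0) := by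
    have : Filter.Tendsto (fun t : ℝ => C * ‖u‖ ^ (d + 1) * t) (𝓝 0)
        (𝓝 (C * ‖u‖ ^ (d + 1) * 0)) := Continuous.tendsto (by fun_prop) 0
    rw [mul_zero] at this
    exact this.mono_left nhdsWithin_le_nhds
  exact norm_le_zero_iff.1 (ge_of_tendsto h3 h2)

/-- By homogeneity the sum vanishes identically. On the unit circle `z̄ = 1 / z`, so multiplication
by `z ^ d` turns it into a polynomial in `z` with infinitely many roots. -/
theorem coeff_eq_zero_of_isBigO {c : ℕ × ℕ → ℂ} {d : ℕ}
    (h : (fun z : ℂ => ∑ x ∈ antidiagonal d, c x * z ^ x.1 * starRingEnd ℂ z ^ x.2) =O[𝓝 0]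
      fun z => ‖z‖ ^ (d + 1)) : ∀ x ∈ antidiagonal d, c x = 0 := by
  have h0 := eq_zero_of_homogeneous_of_isBigO (fun t u => by
    rw [Finset.mul_sum]
    refine Finset.sum_congr rfl fun x hx => ?_
    rw [← mem_antidiagonal.1 hx, Complex.real_smul, map_mul, Complex.conj_ofReal]
    ring) h
  -- On the circle `z ^ d * z ^ j * z̄ ^ (d - j) = z ^ (2 * j)`: distinct bidegrees give distinct
  -- exponents.
  have h1 : ∑ j ∈ Finset.range (d + 1),
      Polynomial.C (c (j, d - j)) * Polynomial.X ^ (2 * j) = 0 := by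
    refine Polynomial.eq_zero_of_infinite_isRoot _ (Set.Infinite.mono ?_
      ((isPreconnected_sphere (E := ℂ)
        (by simp [Complex.rank_real_complex]) 0 1).infinite_of_nontrivial ⟨1, by simp, -1, by simp, by norm_num⟩))
    intro z hz
    have hz1 : z * starRingEnd ℂ z = 1 := by
      rw [Complex.mul_conj, Complex.normSq_eq_norm_sq, mem_sphere_zero_iff_norm.1 hz]; simp
    have h2 := congrArg (z ^ d * ·) (h0 z)
    rw [Finset.Nat.sum_antidiagonal_eq_sum_range_succ_mk] at h2
    simp only [mul_zero, Finset.mul_sum] at h2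
    rw [Set.mem_ofPred_eq, Polynomial.IsRoot.def, Polynomial.eval_finsetSum, ← h2]
    refine Finset.sum_congr rfl fun j hj => ?_
    have hj : j ≤ d := Nat.lt_succ_iff.1 (Finset.mem_range.1 hj)
    obtain ⟨k, rfl⟩ := Nat.exists_eq_add_of_le hj
    simp only [Polynomial.eval_mul, Polynomial.eval_C, Polynomial.eval_pow, Polynomial.eval_X,
      add_tsub_cancel_left]
    have h3 : z ^ k * starRingEnd ℂ z ^ k = 1 := by rw [← mul_pow, hz1, one_pow]
    linear_combination (-(c (j, k)) * z ^ (2 * j)) * h3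
  rintro ⟨p, q⟩ hx
  have hx : p + q = d := mem_antidiagonal.1 hx
  have h2 := congrArg (fun P : Polynomial ℂ => P.coeff (2 * p)) h1
  simp only [Polynomial.finsetSum_coeff, Polynomial.coeff_C_mul, Polynomial.coeff_X_pow,
    Polynomial.coeff_zero] at h2
  rw [Finset.sum_eq_single p] at h2
  · simpa [← hx] using h2
  · intro j _ hj
    rw [if_neg (by omega), mul_zero]
  · intro hp
    exact absurd (Finset.mem_range.2 (by omega)) hp

theorem isBigO_norm_pow_of_le {E : Type*} [NormedAddCommGroup E] {a b : ℕ} (h : a ≤ b) :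
    (fun u : E => ‖u‖ ^ b) =O[𝓝 0] fun u => ‖u‖ ^ a := by
  refine Asymptotics.IsBigO.of_bound 1 ?_
  filter_upwards [Metric.ball_mem_nhds (0 : E) one_pos] with u hu
  rw [mem_ball_zero_iff] at hu
  simpa using pow_le_pow_of_le_one (norm_nonneg u) hu.le h

/-- `F (c u) = c ^ p * c̄ ^ q * F u` for complex `c`, and `F u = O(|u| ^ (p + q))`. -/
structure IsBihomogeneous (p q : ℕ) (F : EuclideanSpace ℂ (Fin 2) → ℂ) : Prop where
  smul : ∀ (c : ℂ) u, F (c • u) = c ^ p * (starRingEnd ℂ c) ^ q * F u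
  isBigO : F =O[𝓝 0] fun u => ‖u‖ ^ (p + q)

theorem isBihomogeneous_of_mem {p q : ℕ} {F : EuclideanSpace ℂ (Fin 2) → ℂ}
    (hF : F ∈ bihomogeneous p q) : IsBihomogeneous p q F :=
  ⟨bihomogeneous_smul hF, isBigO_of_mem_bihomogeneous hF⟩

theorem IsBihomogeneous.sub {p q : ℕ} {F G : EuclideanSpace ℂ (Fin 2) → ℂ}
    (hF : IsBihomogeneous p q F) (hG : IsBihomogeneous p q G) : IsBihomogeneous p q (F - G) :=
  ⟨fun c u => by simp only [Pi.sub_apply, hF.smul, hG.smul]; ring, hF.isBigO.sub hG.isBigO⟩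

theorem isBigO_clm_comp {E E' : Type*} [NormedAddCommGroup E] [NormedSpace ℂ E]
    [NormedAddCommGroup E'] [NormedSpace ℂ E'] {f : E' → ℂ} {n : ℕ}
    (hf : f =O[𝓝 0] fun u => ‖u‖ ^ n) (T : E →L[ℂ] E') :
    (fun u => f (T u)) =O[𝓝 0] fun u => ‖u‖ ^ n :=
  (hf.comp_tendsto (T.continuous.tendsto' 0 0 (map_zero T))).trans
    ((T.isBigO_id (𝓝 0)).norm_left.norm_right.pow n)

/-- Uniqueness of jets needs only scaling and size, and these survive a linear substitution without
any expansion of monomials. -/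
theorem IsBihomogeneous.comp_clm {p q : ℕ} {F : EuclideanSpace ℂ (Fin 2) → ℂ}
    (hF : IsBihomogeneous p q F) (T : EuclideanSpace ℂ (Fin 2) →L[ℂ] EuclideanSpace ℂ (Fin 2)) :
    IsBihomogeneous p q fun u => F (T u) :=
  ⟨fun c u => by rw [map_smul, hF.smul], isBigO_clm_comp hF.isBigO T⟩

section Jet
variable {F G : ℕ × ℕ → EuclideanSpace ℂ (Fin 2) → ℂ} {f : EuclideanSpace ℂ (Fin 2) → ℂ}

theorem isBigO_sum_antidiagonal (hF : ∀ x, IsBihomogeneous x.1 x.2 (F x)) (k : ℕ) :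
    (fun u => ∑ x ∈ antidiagonal k, F x u) =O[𝓝 0] fun u => ‖u‖ ^ k := by
  refine Asymptotics.IsBigO.fun_sum fun x hx => ?_
  rw [← mem_antidiagonal.1 hx]
  exact (hF x).isBigO

/-- On the complex line through `u` the sum is a polynomial in `z, z̄` whose coefficients are the
values `F x u`. -/
theorem eq_zero_of_isBigO_sum_antidiagonal (hF : ∀ x, IsBihomogeneous x.1 x.2 (F x)) {k : ℕ}
    (h : (fun u => ∑ x ∈ antidiagonal k, F x u) =O[𝓝 0] fun u => ‖u‖ ^ (k + 1)) :
    ∀ x ∈ antidiagonal k, F x = 0 := by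
  intro x hx
  ext u
  refine coeff_eq_zero_of_isBigO (c := fun x => F x u) (d := k) ?_ x hx
  have h1 : Filter.Tendsto (fun z : ℂ => z • u) (𝓝 0) (𝓝 0) := by
    have : Filter.Tendsto (fun z : ℂ => z • u) (𝓝 0) (𝓝 ((0 : ℂ) • u)) :=
      Continuous.tendsto (by fun_prop) 0
    rwa [zero_smul] at this
  have h2 := (h.comp_tendsto h1).trans (g := fun u => _) (k := fun z : ℂ => ‖z‖ ^ (k + 1)) (by
    refine Asymptotics.IsBigO.of_bound (‖u‖ ^ (k + 1)) (Filter.Eventually.of_forall fun z => ?_)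
    simp [norm_smul, mul_pow, mul_comm])
  refine h2.congr_left fun z => ?_
  simp only [Function.comp_apply]
  refine Finset.sum_congr rfl fun y _ => ?_
  rw [(hF y).smul]
  ring

theorem jetSum_succ (n : ℕ) (F : ℕ × ℕ → EuclideanSpace ℂ (Fin 2) → ℂ)
    (u : EuclideanSpace ℂ (Fin 2)) :
    jetSum (n + 1) F u = jetSum n F u + ∑ x ∈ antidiagonal (n + 1), F x u :=
  Finset.sum_range_succ _ _

theorem eq_zero_of_isBigO_jetSum (hF : ∀ x, IsBihomogeneous x.1 x.2 (F x)) {n : ℕ}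
    (h : jetSum n F =O[𝓝 0] fun u => ‖u‖ ^ (n + 1)) : ∀ x, x.1 + x.2 ≤ n → F x = 0 := by
  induction n with
  | zero =>
    intro x hx
    refine eq_zero_of_isBigO_sum_antidiagonal hF (k := 0) ?_ x (mem_antidiagonal.2 (by omega))
    exact h.congr_left fun u => by simp [jetSum]
  | succ n ih =>
    have h1 := isBigO_sum_antidiagonal hF (n + 1)
    have h2 : ∀ x, x.1 + x.2 ≤ n → F x = 0 := by
      refine ih (((h.trans (isBigO_norm_pow_of_le (by omega))).sub h1).congr_left fun u => ?_)
      rw [jetSum_succ, add_sub_cancel_right]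
    intro x hx
    rcases Nat.lt_or_ge n (x.1 + x.2) with hlt | hle
    · refine eq_zero_of_isBigO_sum_antidiagonal hF (k := n + 1) (h.congr_left fun u => ?_) x
        (mem_antidiagonal.2 (by omega))
      rw [jetSum_succ]
      simp only [add_eq_right]
      refine Finset.sum_eq_zero fun k hk => Finset.sum_eq_zero fun y hy => ?_
      have := mem_antidiagonal.1 hy
      have := Finset.mem_range.1 hk
      rw [h2 y (by omega), Pi.zero_apply]
    · exact h2 x hle

theorem jetSum_sub (n : ℕ) (u : EuclideanSpace ℂ (Fin 2)) :
    jetSum n (F - G) u = jetSum n F u - jetSum n G u := by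
  simp [jetSum, Finset.sum_sub_distrib]

theorem IsJet.mono {n k : ℕ} (h : IsJet n f F) (hk : k ≤ n) : IsJet k f F := by
  induction n, hk using Nat.le_induction with
  | base => exact h
  | succ n _ ih =>
    refine ih ⟨h.mem, ?_⟩
    refine ((h.isBigO.trans (isBigO_norm_pow_of_le (by omega))).add
      (isBigO_sum_antidiagonal (fun x => isBihomogeneous_of_mem (h.mem x)) (n + 1))).congr_left
        fun u => ?_
    rw [jetSum_succ]
    ring

theorem IsJet.unique {n : ℕ} (hF : IsJet n f F) (hG : IsJet n f G) (x : ℕ × ℕ)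
    (hx : x.1 + x.2 ≤ n) : F x = G x := by
  refine sub_eq_zero.1 (eq_zero_of_isBigO_jetSum (F := F - G)
    (fun x => (isBihomogeneous_of_mem (hF.mem x)).sub (isBihomogeneous_of_mem (hG.mem x))) ?_ x hx)
  refine (hG.isBigO.sub hF.isBigO).congr_left fun u => ?_
  rw [jetSum_sub]
  ring

theorem conj_mem_bihomogeneous {p q : ℕ} {H : EuclideanSpace ℂ (Fin 2) → ℂ}
    (hH : H ∈ bihomogeneous p q) : (fun u => starRingEnd ℂ (H u)) ∈ bihomogeneous q p := by
  induction hH using Submodule.span_induction with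
  | mem H hH =>
    obtain ⟨⟨α, β⟩, ⟨h1, h2⟩, rfl⟩ := hH
    refine Submodule.subset_span ⟨(β, α), ⟨h2, h1⟩, ?_⟩
    ext u
    simp [mixedMonomial, mul_comm]
  | zero => convert! (bihomogeneous q p).zero_mem using 1; ext; simp
  | add F G _ _ hF hG => convert! Submodule.add_mem _ hF hG using 1; ext; simp
  | smul a F _ hF =>
    convert! Submodule.smul_mem _ (starRingEnd ℂ a) hF using 1; ext; simp

/-- For real `f`, uniqueness then makes the components of bidegrees `(p, q)` and `(q, p)` conjugate,
so both pure terms of a given degree come from one holomorphic polynomial. -/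
theorem IsJet.conj {n : ℕ} (hF : IsJet n f F) :
    IsJet n (fun u => starRingEnd ℂ (f u)) fun x u => starRingEnd ℂ (F x.swap u) := by
  refine ⟨fun x => conj_mem_bihomogeneous (hF.mem x.swap), ?_⟩
  refine (Asymptotics.isBigO_norm_left.2 hF.isBigO).congr_left (fun u => ?_) |>.of_norm_left
  rw [← RCLike.norm_conj, map_sub, jetSum, jetSum, map_sum]
  congr 2
  refine Finset.sum_congr rfl fun k _ => ?_
  rw [map_sum, ← Finset.Nat.sum_antidiagonal_swap]

end Jet

/-! ### Real parts of holomorphic functions against mixed terms -/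

/-- Induction on the degree. If `h = z ^ j g` and the coefficients of degree below `j` vanish, then
`e = O(|z| ^ (j + 1))` and the part of degree `j` is `Re (g(0) z ^ j)` plus the layer of `c`. It
must vanish, and its `z ^ j` coefficient is `g(0) / 2` because `c (j, 0) = 0`. So `g(0) = 0`, which
raises the order of `h` and kills the layer. Only one of the two kinds of pure coefficient has to be
excluded. -/
theorem re_cancellation {h e : ℂ → ℂ} (hh : AnalyticAt ℂ h 0) (h0 : h 0 = 0) {c : ℕ × ℕ → ℂ}
    (hc : ∀ p, c (p, 0) = 0) {n : ℕ}
    (he : e =O[𝓝 0] fun z => ‖z‖ * ‖h z‖)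
    (H : (fun z => ((h z).re : ℂ) + ∑ k ∈ Finset.range n, ∑ x ∈ antidiagonal k,
      c x * z ^ x.1 * starRingEnd ℂ z ^ x.2 + e z) =O[𝓝 0] fun z => ‖z‖ ^ n) :
    (h =O[𝓝 0] fun z => ‖z‖ ^ n) ∧ ∀ x, x.1 + x.2 < n → c x = 0 := by
  have hS (k : ℕ) : (fun z : ℂ => ∑ x ∈ antidiagonal k,
      c x * z ^ x.1 * starRingEnd ℂ z ^ x.2) =O[𝓝 0] fun z => ‖z‖ ^ k := by
    refine Asymptotics.IsBigO.fun_sum fun x hx => ?_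
    refine Asymptotics.IsBigO.of_bound ‖c x‖ (Filter.Eventually.of_forall fun z => ?_)
    rw [← mem_antidiagonal.1 hx]
    simp [mul_assoc, pow_add]
  have hpow (g : ℂ → ℂ) (hg : AnalyticAt ℂ g 0) (j : ℕ) (hj : ∀ᶠ z in 𝓝 0, h z = z ^ j * g z) :
      h =O[𝓝 0] fun z => ‖z‖ ^ j := by
    have h1 : g =O[𝓝 0] fun _ => (1 : ℝ) := hg.continuousAt.tendsto.isBigO_one ℝ
    have h2 : (fun z : ℂ => z ^ j) =O[𝓝 0] fun z => ‖z‖ ^ j :=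
      Asymptotics.IsBigO.of_bound 1 (Filter.Eventually.of_forall fun z => by simp)
    refine (Filter.EventuallyEq.trans_isBigO hj (h2.mul h1)).congr_right fun z => mul_one _
  suffices hind : ∀ j ≤ n, (∃ g : ℂ → ℂ, AnalyticAt ℂ g 0 ∧ ∀ᶠ z in 𝓝 0, h z = z ^ j * g z) ∧
      ∀ x, x.1 + x.2 < j → c x = 0 by
    obtain ⟨⟨g, hg, hgh⟩, hcx⟩ := hind n le_rfl
    exact ⟨hpow g hg n hgh, hcx⟩
  intro j
  induction j with
  | zero => exact fun _ => ⟨⟨h, hh, by simp⟩, by simp⟩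
  | succ j ih =>
    intro hjn
    obtain ⟨⟨g, hg, hgh⟩, hcx⟩ := ih (by omega)
    have e1 : e =O[𝓝 0] fun z => ‖z‖ ^ (j + 1) := by
      refine he.trans (((Asymptotics.isBigO_refl (fun z : ℂ => ‖z‖) _).mul
        (hpow g hg j hgh).norm_left).congr_right fun z => ?_)
      rw [pow_succ, mul_comm]
    have e2 : (fun z : ℂ => ∑ k ∈ (Finset.range n).erase j, ∑ x ∈ antidiagonal k,
        c x * z ^ x.1 * starRingEnd ℂ z ^ x.2) =O[𝓝 0] fun z => ‖z‖ ^ (j + 1) := by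
      refine Asymptotics.IsBigO.fun_sum fun k hk => ?_
      rcases Nat.lt_or_ge j k with hlt | hle
      · exact (hS k).trans (isBigO_norm_pow_of_le hlt)
      · have hkj : k < j := lt_of_le_of_ne hle (Finset.ne_of_mem_erase hk)
        refine (Asymptotics.isBigO_zero _ _).congr_left fun z => ?_
        refine (Finset.sum_eq_zero fun x hx => ?_).symm
        rw [hcx x (by rw [mem_antidiagonal.1 hx]; exact hkj)]
        ring
    have e3 : (fun z : ℂ => ((h z).re : ℂ) - ((z ^ j * g 0).re : ℝ)) =O[𝓝 0]
        fun z => ‖z‖ ^ (j + 1) := by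
      have h1 : (fun z : ℂ => h z - z ^ j * g 0) =O[𝓝 0] fun z => ‖z‖ ^ (j + 1) := by
        have h2 : (fun z : ℂ => z ^ j) =O[𝓝 0] fun z => ‖z‖ ^ j :=
          Asymptotics.IsBigO.of_bound 1 (Filter.Eventually.of_forall fun z => by simp)
        have h3 := hg.differentiableAt.isBigO_sub
        refine Filter.EventuallyEq.trans_isBigO (hgh.mono fun z hz => ?_)
          ((h2.mul h3.norm_right).congr_right fun z => ?_)
        · show _ = z ^ j * (g z - g 0)
          simp only [hz]; ring
        · rw [sub_zero, pow_succ]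
      refine Asymptotics.IsBigO.trans (Asymptotics.IsBigO.of_bound 1
        (Filter.Eventually.of_forall fun z => ?_)) h1
      rw [one_mul, ← Complex.ofReal_sub, ← Complex.sub_re, Complex.norm_real]
      exact Complex.abs_re_le_norm _
    let c' : ℕ × ℕ → ℂ := fun x => (if x = (j, 0) then g 0 / 2 else 0) +
      if x = (0, j) then starRingEnd ℂ (g 0) / 2 else 0
    have e4 := coeff_eq_zero_of_isBigO (c := c + c') (d := j) (by
      refine ((((H.trans (isBigO_norm_pow_of_le hjn)).sub e1).sub e2).sub e3).congr_left
        fun z => ?_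
      rw [← Finset.add_sum_erase (Finset.range n) _ (Finset.mem_range.2 hjn)]
      have h2 : ∑ x ∈ antidiagonal j, c' x * z ^ x.1 * starRingEnd ℂ z ^ x.2 =
          ((z ^ j * g 0).re : ℝ) := by
        simp only [c', add_mul, ite_mul, zero_mul, Finset.sum_add_distrib]
        rw [Finset.sum_ite_eq' _ (j, 0), Finset.sum_ite_eq' _ (0, j),
          if_pos (mem_antidiagonal.2 (by simp)), if_pos (mem_antidiagonal.2 (by simp)),
          Complex.re_eq_add_conj]
        simp
        ring
      simp only [Pi.add_apply, add_mul, Finset.sum_add_distrib]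
      rw [h2]
      ring)
    -- For `j = 0` the two pure monomials coincide and the comparison would only see `Re g(0)`;
    -- there `h 0 = 0` is used instead.
    have hg0 : g 0 = 0 := by
      rcases Nat.eq_zero_or_pos j with rfl | hj
      · have := hgh.self_of_nhds
        simpa [h0] using this.symm
      · have := e4 (j, 0) (mem_antidiagonal.2 (by simp))
        simp only [Pi.add_apply, hc, c', zero_add, if_true, Prod.mk.injEq, hj.ne', false_and,
          if_false, add_zero] at this
        simpa using this
    refine ⟨?_, fun x hx => ?_⟩
    · have h1 : ((1 : ℕ) : ℕ∞) ≤ analyticOrderAt g 0 := by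
        rw [Nat.cast_one, Order.one_le_iff_ne_zero]
        exact hg.analyticOrderAt_ne_zero.2 hg0
      obtain ⟨g', hg', hgg'⟩ := (natCast_le_analyticOrderAt hg).1 h1
      refine ⟨g', hg', ?_⟩
      filter_upwards [hgh, hgg'] with z h1 h2
      rw [h1, h2]
      simp [pow_succ]
      ring
    · rcases Nat.lt_or_ge (x.1 + x.2) j with hlt | hle
      · exact hcx x hlt
      · have := e4 x (mem_antidiagonal.2 (by omega))
        simpa [c', hg0] using this

/-! ### Removal of the pure terms -/

/-- Let `g` be the component of bidegree `(k + 1, 0)`. Since `dr(0) = Re s`, replacing `h` by `h -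
2g` changes `r` on the graph by `-(g + ḡ) + O(|u| ^ (k + 2))`: exactly the pure terms of degree `k +
1` disappear, and the other components up to that degree are untouched. -/
theorem exists_graph_without_pure_terms {r : EuclideanSpace ℂ (Fin 2) × ℂ → ℝ}
    (hr : ContDiffAt ℝ ∞ r 0) (r0 : r 0 = 0) (hdr : ∀ x, fderiv ℝ r 0 x = x.2.re) {n : ℕ}
    (hn : 1 ≤ n) :
    ∃ (h : EuclideanSpace ℂ (Fin 2) → ℂ) (F : ℕ × ℕ → EuclideanSpace ℂ (Fin 2) → ℂ),
      ContDiff ℂ ω h ∧ (h =O[𝓝 0] fun u => ‖u‖ ^ 2) ∧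
      IsJet n (fun u => (r (u, h u) : ℂ)) F ∧ ∀ x : ℕ × ℕ, x.1 = 0 ∨ x.2 = 0 → F x = 0 := by
  have hlip := isBigO_sub_sub_fderiv (hr.of_le ENat.LEInfty.out)
  induction n, hn using Nat.le_induction with
  | base =>
    refine ⟨0, 0, contDiff_const, Asymptotics.isBigO_zero _ _,
      ⟨fun x => Submodule.zero_mem _, ?_⟩, fun _ _ => rfl⟩
    have ht : Filter.Tendsto (fun u : EuclideanSpace ℂ (Fin 2) =>
        (((u, 0), 0) : (EuclideanSpace ℂ (Fin 2) × ℂ) × EuclideanSpace ℂ (Fin 2) × ℂ))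
        (𝓝 0) (𝓝 0) := Continuous.tendsto' (by fun_prop) _ _ rfl
    have h1 := hlip.comp_tendsto ht
    refine Asymptotics.IsBigO.trans (Asymptotics.IsBigO.of_norm_left
      ((Asymptotics.isBigO_norm_left.2 h1).congr_left fun u => ?_))
      (Asymptotics.IsBigO.of_bound 1 (Filter.Eventually.of_forall fun u => ?_))
    · simp [jetSum, hdr, r0]
    · simp [pow_two]
  | succ k hk ih =>
    obtain ⟨h, F, hh, hO, hF, hpure⟩ := ih
    have hf : ContDiffAt ℝ ∞ (fun u => (r (u, h u) : ℂ)) 0 := by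
      have h1 : ContDiffAt ℝ ∞ (fun u => (u, h u)) (0 : EuclideanSpace ℂ (Fin 2)) :=
        contDiffAt_id.prodMk ((hh.contDiffAt.of_le le_top).restrict_scalars ℝ)
      have h2 : h 0 = 0 := by simpa using hO.eq_zero_imp.self_of_nhds
      have h3 : ContDiffAt ℝ ∞ r ((fun u => (u, h u)) (0 : EuclideanSpace ℂ (Fin 2))) := by
        simpa only [h2, ← Prod.zero_eq_mk] using hr
      exact Complex.ofRealCLM.contDiff.contDiffAt.comp 0 (h3.comp 0 h1)
    obtain ⟨G, hG⟩ := exists_isJet hf (k + 1)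
    have hGF : ∀ x : ℕ × ℕ, x.1 + x.2 ≤ k → G x = F x := (hG.mono (by omega)).unique hF
    have hconj : ∀ u, G (0, k + 1) u = starRingEnd ℂ (G (k + 1, 0) u) := by
      have h1 : IsJet (k + 1) (fun u => (r (u, h u) : ℂ))
          fun x u => starRingEnd ℂ (G x.swap u) := by
        simpa only [Complex.conj_ofReal] using hG.conj
      intro u
      rw [hG.unique h1 (0, k + 1) (zero_add _).le]
      rfl
    set g := G (k + 1, 0) with hg
    have hgb : g ∈ bihomogeneous (k + 1) 0 := hG.mem (k + 1, 0)
    have hgO : g =O[𝓝 0] fun u => ‖u‖ ^ (k + 1) :=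
      isBigO_of_mem_bihomogeneous (p := k + 1) (q := 0) hgb
    have hO' : (fun u => h u - 2 * g u) =O[𝓝 0] fun u => ‖u‖ ^ 2 :=
      hO.sub ((hgO.trans (isBigO_norm_pow_of_le (by omega))).const_mul_left 2)
    let F' : ℕ × ℕ → EuclideanSpace ℂ (Fin 2) → ℂ := fun x => if x.1 = 0 ∨ x.2 = 0 then 0 else G x
    have hF' : ∀ x, F' x ∈ bihomogeneous x.1 x.2 := fun x => by
      simp only [F']
      split_ifs
      · exact Submodule.zero_mem _
      · exact hG.mem x
    refine ⟨fun u => h u - 2 * g u, F', hh.sub (contDiff_const.mul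
      (contDiff_of_mem_bihomogeneous_zero hgb)), hO', ⟨hF', ?_⟩, fun x hx => if_pos hx⟩
    have hsum (u : EuclideanSpace ℂ (Fin 2)) :
        jetSum (k + 1) G u = jetSum (k + 1) F' u + (2 * g u).re := by
      rw [jetSum_succ, jetSum_succ, add_assoc]
      congr 1
      · refine Finset.sum_congr rfl fun j hj => Finset.sum_congr rfl fun x hx => ?_
        have hx := mem_antidiagonal.1 hx
        have hj := Finset.mem_range.1 hj
        simp only [F']
        split_ifs with hx0
        · rw [hGF x (by omega), hpure x hx0]
        · rfl
      · have h1 : ∀ x ∈ antidiagonal (k + 1), G x u = F' x u +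
            ((if x = (k + 1, 0) then g u else 0) +
              if x = (0, k + 1) then starRingEnd ℂ (g u) else 0) := by
          rintro ⟨p, q⟩ hx
          have hx : p + q = k + 1 := mem_antidiagonal.1 hx
          rcases Nat.eq_zero_or_pos p with rfl | hp
          · obtain rfl : q = k + 1 := by omega
            simp [F', hconj]
          · rcases Nat.eq_zero_or_pos q with rfl | hq
            · obtain rfl : p = k + 1 := by omega
              simp [F', hg]
            · simp [F', hp.ne', hq.ne']
        rw [Finset.sum_congr rfl h1, Finset.sum_add_distrib, Finset.sum_add_distrib,
          Finset.sum_ite_eq' _ (k + 1, 0), Finset.sum_ite_eq' _ (0, k + 1),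
          if_pos (mem_antidiagonal.2 (by simp)), if_pos (mem_antidiagonal.2 (by simp)),
          Complex.add_conj]
        simp
    have hid : (fun u : EuclideanSpace ℂ (Fin 2) => u) =O[𝓝 0] fun u => ‖u‖ :=
      (Asymptotics.isBigO_refl _ _).norm_right
    have hp : (fun u => ((u, h u - 2 * g u), (u, h u))) =O[𝓝 0]
        fun u : EuclideanSpace ℂ (Fin 2) => ‖u‖ := by
      have h2 := isBigO_norm_pow_of_le (E := EuclideanSpace ℂ (Fin 2)) (one_le_two)
      simp only [pow_one] at h2
      exact (hid.prod_left (hO'.trans h2)).prod_left (hid.prod_left (hO.trans h2))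
    have ht : Filter.Tendsto (fun u => ((u, h u - 2 * g u), (u, h u))) (𝓝 0) (𝓝 0) :=
      hp.trans_tendsto (by simpa using (continuous_norm.tendsto (0 : EuclideanSpace ℂ (Fin 2))))
    -- Both points of the comparison are `O(|u|)` and they differ by `2g = O(|u| ^ (k + 1))`, which
    -- yields the extra order.
    have h1 : (fun u => r (u, h u - 2 * g u) - r (u, h u) + (2 * g u).re) =O[𝓝 0]
        fun u => ‖u‖ ^ (k + 1 + 1) := by
      refine ((hlip.comp_tendsto ht).trans (g := _) (k := fun u => ‖u‖ * ‖u‖ ^ (k + 1))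
        (hp.norm_left.mul ?_)).congr (fun u => ?_) (fun u => ?_)
      · refine Asymptotics.IsBigO.trans (Asymptotics.IsBigO.of_bound 2
          (Filter.Eventually.of_forall fun u => ?_)) hgO
        simp
      · simp [hdr]
      · ring
    have h2 : (fun u => ((r (u, h u - 2 * g u) - r (u, h u) + (2 * g u).re : ℝ) : ℂ)) =O[𝓝 0]
        fun u => ‖u‖ ^ (k + 1 + 1) :=
      (Complex.isBigO_ofReal_left).2 h1
    refine (hG.isBigO.add h2).congr_left fun u => ?_
    rw [hsum u]
    push_cast
    ring

/-! ### Local inverses and adapted frames -/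

theorem exists_analytic_local_inverse {X E : Type*} [NormedAddCommGroup X] [NormedSpace ℂ X]
    [FiniteDimensional ℂ X] [NormedAddCommGroup E] [NormedSpace ℂ E] [FiniteDimensional ℂ E]
    {Ψ : X → E} (hΨ : AnalyticAt ℂ Ψ 0) (h0 : Ψ 0 = 0)
    (hb : Function.Bijective (fderiv ℂ Ψ 0)) :
    ∃ Θ : E → X, AnalyticAt ℂ Θ 0 ∧ Θ 0 = 0 ∧ (∀ᶠ x in 𝓝 0, Θ (Ψ x) = x) ∧
      ∀ᶠ y in 𝓝 0, Ψ (Θ y) = y := by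
  have := FiniteDimensional.complete ℂ X
  have := FiniteDimensional.complete ℂ E
  let e : X ≃L[ℂ] E :=
    (LinearEquiv.ofBijective (fderiv ℂ Ψ 0 : X →ₗ[ℂ] E) hb).toContinuousLinearEquiv
  have hd : HasFDerivAt Ψ (e : X →L[ℂ] E) 0 := by
    convert! hΨ.differentiableAt.hasFDerivAt using 1
  have hc : ContDiffAt ℂ ω Ψ 0 := hΨ.contDiffAt
  have hs : HasStrictFDerivAt Ψ (e : X →L[ℂ] E) 0 := hc.hasStrictFDerivAt' hd (by simp)
  refine ⟨hs.localInverse Ψ e 0, ?_, ?_, hs.eventually_left_inverse, ?_⟩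
  · have := hc.to_localInverse hd (by simp)
    rw [h0] at this
    exact this.analyticAt
  · have := hs.localInverse_apply_image
    rwa [h0] at this
  · have := hs.eventually_right_inverse
    rwa [h0] at this

/-- The complex linear map `(u, s) ↦ u₁ v + u₂ e + s e'`. -/
noncomputable def frameMap {E : Type*} [NormedAddCommGroup E] [NormedSpace ℂ E] (v e e' : E) :
    EuclideanSpace ℂ (Fin 2) × ℂ →L[ℂ] E :=
  (((EuclideanSpace.proj (0 : Fin 2) : EuclideanSpace ℂ (Fin 2) →L[ℂ] ℂ).comp
      (ContinuousLinearMap.fst ℂ _ ℂ)).smulRight v +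
    ((EuclideanSpace.proj (1 : Fin 2) : EuclideanSpace ℂ (Fin 2) →L[ℂ] ℂ).comp
      (ContinuousLinearMap.fst ℂ _ ℂ)).smulRight e) +
    (ContinuousLinearMap.snd ℂ _ ℂ).smulRight e'

section Frame
variable {E : Type*} [NormedAddCommGroup E] [NormedSpace ℂ E]

theorem frameMap_apply (v e e' : E) (x : EuclideanSpace ℂ (Fin 2) × ℂ) :
    frameMap v e e' x = x.1 0 • v + x.1 1 • e + x.2 • e' := by
  simp [frameMap]

theorem eq_zero_of_smul_add_smul_eq_zero {v e : E} (hv0 : v ≠ 0)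
    (hev : e ∉ Submodule.span ℂ {v}) {u : EuclideanSpace ℂ (Fin 2)}
    (hx : u 0 • v + u 1 • e = 0) : u = 0 := by
  have h1 : u 1 = 0 := by
    by_contra h
    refine hev (Submodule.mem_span_singleton.2 ⟨-(u 1)⁻¹ * u 0, ?_⟩)
    have h2 : u 0 • v = -(u 1 • e) := eq_neg_of_add_eq_zero_left hx
    rw [mul_smul, h2, smul_neg, neg_smul, neg_neg, inv_smul_smul₀ h]
  rw [h1, zero_smul, add_zero] at hx
  have h0 : u 0 = 0 := (smul_eq_zero.1 hx).resolve_right hv0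
  ext i
  fin_cases i
  · exact h0
  · exact h1

theorem frameMap_injective {ℓ : E →L[ℂ] ℂ} {v e e' : E} (hv : ℓ v = 0) (he : ℓ e = 0)
    (he' : ℓ e' = 1) (hv0 : v ≠ 0) (hev : e ∉ Submodule.span ℂ {v}) :
    Function.Injective (frameMap v e e') := by
  rw [injective_iff_map_eq_zero]
  rintro ⟨u, s⟩ hx
  rw [frameMap_apply] at hx
  have hs : s = 0 := by simpa [hv, he, he'] using congrArg ℓ hx
  subst hs
  simp only [zero_smul, add_zero] at hx
  exact Prod.ext (eq_zero_of_smul_add_smul_eq_zero hv0 hev hx) rfl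

theorem exists_mem_ker_notMem_span (hE : 3 ≤ Module.finrank ℂ E) (ℓ : E →L[ℂ] ℂ) (v : E) :
    ∃ e, ℓ e = 0 ∧ e ∉ Submodule.span ℂ {v} := by
  have : FiniteDimensional ℂ E := Module.finite_of_finrank_pos (by omega)
  by_contra! h
  have h1 : LinearMap.ker (ℓ : E →ₗ[ℂ] ℂ) ≤ Submodule.span ℂ {v} := fun e he => h e he
  have h2 := Submodule.finrank_mono h1
  have h3 := finrank_span_le_card (R := ℂ) ({v} : Set E)
  rw [Set.toFinset_singleton, Finset.card_singleton] at h3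
  have h4 := LinearMap.finrank_range_add_finrank_ker (ℓ : E →ₗ[ℂ] ℂ)
  have h5 := Submodule.finrank_le (LinearMap.range (ℓ : E →ₗ[ℂ] ℂ))
  rw [Module.finrank_self] at h5
  omega

theorem frameMap_bijective [FiniteDimensional ℂ E] (hE : Module.finrank ℂ E = 3) {v e e' : E}
    (h : Function.Injective (frameMap v e e')) : Function.Bijective (frameMap v e e') :=
  ⟨h, (LinearMap.injective_iff_surjective_of_finrank_eq_finrank
    (f := (frameMap v e e' : EuclideanSpace ℂ (Fin 2) × ℂ →ₗ[ℂ] E)) (by simp [hE])).1 h⟩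

end Frame

/-! ### Bounds for the Bloom–Graham type -/

theorem natCast_le_bloomGrahamType {n k : ℕ} {R : EuclideanSpace ℂ (Fin (n + 1)) → ℝ}
    {p : EuclideanSpace ℂ (Fin (n + 1))}
    {φ : EuclideanSpace ℂ (Fin n) → EuclideanSpace ℂ (Fin (n + 1))} (hφ : IsSubmanifoldParam φ p)
    (h : (fun ζ => R (φ ζ)) =O[𝓝 0] fun ζ => ‖ζ‖ ^ k) : (k : ℕ∞) ≤ bloomGrahamType R p :=
  (le_iSup₂_of_le (f := fun (k : ℕ) (_ : (fun ζ => R (φ ζ)) =O[𝓝 0] fun ζ => ‖ζ‖ ^ k) => (k : ℕ∞))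
    k h le_rfl).trans (le_iSup₂_of_le (f := fun φ (_ : IsSubmanifoldParam φ p) =>
      vanishingOrder fun ζ => R (φ ζ)) φ hφ le_rfl)

/-- Orders are integers, so exceeding `k` means reaching `k + 1`. With `k = m - 1` this provides a
submanifold of full contact `m`, so a finite positive supremum is attained. -/
theorem exists_contact_of_lt_bloomGrahamType {n k : ℕ} {R : EuclideanSpace ℂ (Fin (n + 1)) → ℝ}
    {p : EuclideanSpace ℂ (Fin (n + 1))} (h : (k : ℕ∞) < bloomGrahamType R p) :
    ∃ φ : EuclideanSpace ℂ (Fin n) → EuclideanSpace ℂ (Fin (n + 1)), IsSubmanifoldParam φ p ∧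
      (fun ζ => R (φ ζ)) =O[𝓝 0] fun ζ => ‖ζ‖ ^ (k + 1) := by
  simp only [bloomGrahamType, vanishingOrder, lt_iSup_iff] at h
  obtain ⟨φ, hφ, j, hj, hkj⟩ := h
  exact ⟨φ, hφ, hj.trans (isBigO_norm_pow_of_le (by exact_mod_cast hkj))⟩

/-- A complex plane in the kernel of the complex-linear `ℓ` with `Re ℓ = dR(0)` has contact at least
`2`, by the first-order expansion of `R`. -/
theorem two_le_bloomGrahamType {R : EuclideanSpace ℂ (Fin 3) → ℝ} (hR : ContDiff ℝ ∞ R)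
    (hR0 : R 0 = 0) : (2 : ℕ∞) ≤ bloomGrahamType R 0 := by
  let ℓ : StrongDual ℂ (EuclideanSpace ℂ (Fin 3)) := StrongDual.extendRCLike (fderiv ℝ R 0)
  have hℓ (ξ) : (ℓ ξ).re = fderiv ℝ R 0 ξ := StrongDual.re_extendRCLike_apply (𝕜 := ℂ) _ _
  -- Avoiding the span of `0` just means being nonzero.
  obtain ⟨v, hv, hv0⟩ := exists_mem_ker_notMem_span (by simp) ℓ 0
  have hv0 : v ≠ 0 := by rintro rfl; exact hv0 (Submodule.zero_mem _)
  obtain ⟨e, he, hev⟩ := exists_mem_ker_notMem_span (by simp) ℓ v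
  let φ : EuclideanSpace ℂ (Fin 2) →L[ℂ] EuclideanSpace ℂ (Fin 3) :=
    (EuclideanSpace.proj (0 : Fin 2) : EuclideanSpace ℂ (Fin 2) →L[ℂ] ℂ).smulRight v +
      (EuclideanSpace.proj (1 : Fin 2) : EuclideanSpace ℂ (Fin 2) →L[ℂ] ℂ).smulRight e
  have hφ (u) : φ u = u 0 • v + u 1 • e := by simp [φ]
  have hinj : Function.Injective φ := by
    rw [injective_iff_map_eq_zero]
    intro u hu
    rw [hφ] at hu
    exact eq_zero_of_smul_add_smul_eq_zero hv0 hev hu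
  refine natCast_le_bloomGrahamType (k := 2) (φ := φ) ⟨φ.analyticAt 0, map_zero φ, ?_⟩ ?_
  · rw [φ.fderiv]; exact hinj
  · have h1 := isBigO_sub_sub_fderiv (hR.contDiffAt (x := 0) |>.of_le (m := 2) ENat.LEInfty.out)
    have ht : Filter.Tendsto (fun u : EuclideanSpace ℂ (Fin 2) =>
        ((φ u, 0) : EuclideanSpace ℂ (Fin 3) × EuclideanSpace ℂ (Fin 3))) (𝓝 0) (𝓝 0) :=
      Continuous.tendsto' (by fun_prop) _ _ (by simp)
    refine ((h1.comp_tendsto ht).trans (g := _) (k := fun u => ‖u‖ ^ 2)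
      (Asymptotics.IsBigO.of_bound (‖φ‖ ^ 2) (Filter.Eventually.of_forall fun u => ?_))).congr_left
        fun u => ?_
    · simp only [Function.comp_apply, sub_zero, Prod.norm_mk, norm_zero, norm_mul, norm_norm,
        norm_pow]
      rw [max_eq_left (norm_nonneg _), norm_norm, ← mul_pow, ← pow_two]
      gcongr
      exact φ.le_opNorm u
    · have : ℓ (φ u) = 0 := by rw [hφ]; simp [hv, he]
      simp [hR0, ← hℓ, this]

theorem tangent_of_contact {R : EuclideanSpace ℂ (Fin 3) → ℝ} (hR : DifferentiableAt ℝ R 0)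
    {γ : ℂ → EuclideanSpace ℂ (Fin 3)} (hγ : IsSubmanifoldParam γ 0)
    (hO : (fun t => R (γ t)) =O[𝓝 0] fun t => ‖t‖ ^ 2) (t : ℂ) :
    fderiv ℝ R 0 (fderiv ℂ γ 0 t) = 0 := by
  have h1 : HasFDerivAt γ ((fderiv ℂ γ 0).restrictScalars ℝ) 0 :=
    hγ.analyticAt.differentiableAt.hasFDerivAt.restrictScalars ℝ
  have h2 : HasFDerivAt R (fderiv ℝ R 0) (γ 0) := by
    rw [hγ.map_zero]; exact hR.hasFDerivAt
  have h3 := h2.comp 0 h1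
  have h5 : R (γ 0) = 0 := by simpa using hO.eq_zero_imp.self_of_nhds
  have h4 : HasFDerivAt (R ∘ γ) (0 : ℂ →L[ℝ] ℝ) 0 := by
    refine HasFDerivAt.of_isLittleO ?_
    simp only [Function.comp_apply, h5, sub_zero, zero_apply]
    refine hO.trans_isLittleO ?_
    have := Asymptotics.isLittleO_norm_pow_id (E' := ℂ) one_lt_two
    exact this
  exact congrArg (fun L : ℂ →L[ℝ] ℝ => L t) (h3.unique h4)

/-! ### Coordinates adapted to `V` without pure terms -/

/-- Holomorphic coordinates `w = Ψ (u, s)` in which `R = Re s` up to a function of `u` whose Taylor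
polynomial of order `n` has the bihomogeneous components `F` and no pure terms, and up to an error
`O(|s| |(u, s)|)`. -/
structure IsPureFreeCoordinates (R : EuclideanSpace ℂ (Fin 3) → ℝ) (n : ℕ)
    (Ψ : EuclideanSpace ℂ (Fin 2) × ℂ → EuclideanSpace ℂ (Fin 3))
    (F : ℕ × ℕ → EuclideanSpace ℂ (Fin 2) → ℂ) : Prop where
  analyticAt : AnalyticAt ℂ Ψ 0
  map_zero : Ψ 0 = 0
  bijective_fderiv : Function.Bijective (fderiv ℂ Ψ 0)
  isBigO : (fun x => R (Ψ x) - R (Ψ (x.1, 0)) - x.2.re) =O[𝓝 0] fun x => ‖x‖ * ‖x.2‖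
  isJet : IsJet n (fun u => (R (Ψ (u, 0)) : ℂ)) F
  pure : ∀ x : ℕ × ℕ, x.1 = 0 ∨ x.2 = 0 → F x = 0

theorem isBigO_comp_curve {R : EuclideanSpace ℂ (Fin 3) → ℝ} {V : Set (EuclideanSpace ℂ (Fin 3))}
    {γ : ℂ → EuclideanSpace ℂ (Fin 3)} (hγ : IsSubmanifoldParam γ 0)
    (hmap : Filter.map γ (𝓝 0) = 𝓝[V] 0) {η : ℕ}
    (hcontact : ∃ C : ℝ, ∀ᶠ w in 𝓝[V] (0 : EuclideanSpace ℂ (Fin 3)), |R w| ≤ C * ‖w‖ ^ η) :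
    (fun t => R (γ t)) =O[𝓝 0] fun t => ‖t‖ ^ η := by
  obtain ⟨C, hC⟩ := hcontact
  rw [← hmap, Filter.eventually_map] at hC
  have h1 : γ =O[𝓝 0] fun t => ‖t‖ := by
    simpa [hγ.map_zero] using hγ.analyticAt.differentiableAt.isBigO_sub.norm_right
  refine Asymptotics.IsBigO.trans (Asymptotics.IsBigO.of_bound C ?_) (h1.norm_left.pow η)
  filter_upwards [hC] with t ht
  simpa using ht

/-- The map `Φ` uses the parametrization of `V` as its `u₁`-axis, with the other directions `e ∈ ker
ℓ` and `ℓ e' = 1`, so that `d(R ∘ Φ)(0) = Re s`. The shift `s ↦ s + h(u)` then removes the pure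
terms, and `V` becomes the graph `s = -h(u₁, 0)` over the `u₁`-axis. -/
theorem exists_isPureFreeCoordinates {R : EuclideanSpace ℂ (Fin 3) → ℝ} (hR : ContDiff ℝ ∞ R)
    (hR0 : R 0 = 0) (hdR : fderiv ℝ R 0 ≠ 0) {V : Set (EuclideanSpace ℂ (Fin 3))}
    (hV : IsSmoothCurveAt V 0) {η : ℕ} (hη : 2 ≤ η)
    (hcontact : ∃ C : ℝ, ∀ᶠ w in 𝓝[V] (0 : EuclideanSpace ℂ (Fin 3)), |R w| ≤ C * ‖w‖ ^ η) :
    ∃ Ψ F, IsPureFreeCoordinates R η Ψ F ∧ ∃ g : ℂ → ℂ, AnalyticAt ℂ g 0 ∧ g 0 = 0 ∧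
      ∀ᶠ x in 𝓝 0, Ψ x ∈ V ↔ x.1 1 = 0 ∧ x.2 = g (x.1 0) := by
  obtain ⟨γ, hγ, hmap⟩ := hV
  have hO := isBigO_comp_curve hγ hmap hcontact
  have htan := tangent_of_contact (hR.contDiffAt.differentiableAt (by simp)) hγ
    (hO.trans (isBigO_norm_pow_of_le hη))
  let ℓ : StrongDual ℂ (EuclideanSpace ℂ (Fin 3)) := StrongDual.extendRCLike (fderiv ℝ R 0)
  have hℓ (ξ) : (ℓ ξ).re = fderiv ℝ R 0 ξ := StrongDual.re_extendRCLike_apply (𝕜 := ℂ) _ _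
  set v := fderiv ℂ γ 0 1 with hv
  have hγv (t : ℂ) : fderiv ℂ γ 0 t = t • v := by
    rw [hv, ← map_smul, smul_eq_mul, mul_one]
  have hv0 : v ≠ 0 := fun h => one_ne_zero (hγ.injective_fderiv (h.trans (map_zero _).symm))
  -- Both `v` and `iv` are tangent to the curve, so `dR(0)` kills both; these are the real and
  -- imaginary parts of `ℓ v`.
  have hℓv : ℓ v = 0 := by
    apply Complex.ext
    · rw [hℓ, htan 1, Complex.zero_re]
    · have h1 := hℓ (Complex.I • v)
      rw [← hγv, htan, hγv, map_smul] at h1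
      simpa using h1
  obtain ⟨e, hℓe, hev⟩ := exists_mem_ker_notMem_span (by simp) ℓ v
  obtain ⟨e', hℓe'⟩ : ∃ e', ℓ e' = 1 := by
    have h1 : ∃ ξ, ℓ ξ ≠ 0 := by
      by_contra! h
      refine hdR (ContinuousLinearMap.ext fun ξ => ?_)
      rw [← hℓ, h]; rfl
    obtain ⟨ξ, hξ⟩ := h1
    exact ⟨(ℓ ξ)⁻¹ • ξ, by simp [hξ]⟩
  have hbij := frameMap_bijective (by simp) (frameMap_injective hℓv hℓe hℓe' hv0 hev)
  let Φ : EuclideanSpace ℂ (Fin 2) × ℂ → EuclideanSpace ℂ (Fin 3) :=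
    fun x => γ (x.1 0) + x.1 1 • e + x.2 • e'
  let π (i : Fin 2) : EuclideanSpace ℂ (Fin 2) × ℂ →L[ℂ] ℂ :=
    (EuclideanSpace.proj i : EuclideanSpace ℂ (Fin 2) →L[ℂ] ℂ).comp
      (ContinuousLinearMap.fst ℂ _ ℂ)
  have hΦa : AnalyticAt ℂ Φ 0 := by
    have h1 : AnalyticAt ℂ (fun x => γ (π 0 x)) 0 :=
      AnalyticAt.fun_comp (by rw [map_zero]; exact hγ.analyticAt) ((π 0).analyticAt 0)
    exact (h1.add (((π 1).smulRight e).analyticAt 0)).add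
      (((ContinuousLinearMap.snd ℂ (EuclideanSpace ℂ (Fin 2)) ℂ).smulRight e').analyticAt 0)
  have hΦ0 : Φ 0 = 0 := by simp [Φ, hγ.map_zero]
  have hΦd : HasFDerivAt Φ (frameMap v e e') 0 := by
    have h0 : HasFDerivAt γ (fderiv ℂ γ 0) (π 0 0) := by
      rw [map_zero]; exact hγ.analyticAt.differentiableAt.hasFDerivAt
    have h1 := ((h0.comp 0 (π 0).hasFDerivAt).add ((π 1).smulRight e).hasFDerivAt).add
      ((ContinuousLinearMap.snd ℂ (EuclideanSpace ℂ (Fin 2)) ℂ).smulRight e').hasFDerivAt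
    convert! h1 using 1
    ext x <;> simp [frameMap_apply, hγv, π]
  have hr : ContDiffAt ℝ ∞ (fun x => R (Φ x)) 0 :=
    hR.contDiffAt.comp 0 ((hΦa.contDiffAt (n := ∞)).restrict_scalars ℝ)
  have hdr (x) : fderiv ℝ (fun x => R (Φ x)) 0 x = x.2.re := by
    have h1 : HasFDerivAt R (fderiv ℝ R 0) (Φ 0) := by
      rw [hΦ0]; exact (hR.contDiffAt.differentiableAt (by simp)).hasFDerivAt
    have h2 : HasFDerivAt (fun x => R (Φ x)) _ 0 := h1.comp 0 (hΦd.restrictScalars ℝ)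
    rw [h2.fderiv]
    simp [← hℓ, frameMap_apply, hℓv, hℓe, hℓe']
  have hlip := isBigO_sub_sub_fderiv (hr.of_le (m := 2) ENat.LEInfty.out)
  obtain ⟨h, F, hh, hhO, hF, hpure⟩ := exists_graph_without_pure_terms (n := η) hr
    (by rw [hΦ0, hR0]) hdr (by omega)
  have hh0 : h 0 = 0 := by simpa using hhO.eq_zero_imp.self_of_nhds
  have hha : AnalyticAt ℂ h 0 := hh.contDiffAt.analyticAt
  have hhd : HasFDerivAt h (0 : EuclideanSpace ℂ (Fin 2) →L[ℂ] ℂ) 0 := by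
    refine HasFDerivAt.of_isLittleO ?_
    simp only [hh0, sub_zero, zero_apply]
    exact hhO.trans_isLittleO
      (Asymptotics.isLittleO_norm_pow_id (E' := EuclideanSpace ℂ (Fin 2)) one_lt_two)
  let Q : EuclideanSpace ℂ (Fin 2) × ℂ → EuclideanSpace ℂ (Fin 2) × ℂ :=
    fun x => (x.1, x.2 + h x.1)
  have hQ0 : Q 0 = 0 := by simp [Q, hh0]
  have hQa : AnalyticAt ℂ Q 0 := by
    have h1 : AnalyticAt ℂ (fun x : EuclideanSpace ℂ (Fin 2) × ℂ => h x.1) 0 :=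
      AnalyticAt.fun_comp (f := Prod.fst) hha analyticAt_fst
    exact analyticAt_fst.prod (analyticAt_snd.add h1)
  have hQd : HasFDerivAt Q (ContinuousLinearMap.id ℂ _) 0 := by
    have h1 : HasFDerivAt h (0 : EuclideanSpace ℂ (Fin 2) →L[ℂ] ℂ)
      (Prod.fst (0 : EuclideanSpace ℂ (Fin 2) × ℂ)) := hhd
    have h2 := (hasFDerivAt_fst (𝕜 := ℂ) (p := (0 : EuclideanSpace ℂ (Fin 2) × ℂ))).prodMk
      ((hasFDerivAt_snd (𝕜 := ℂ)).add (h1.comp 0 hasFDerivAt_fst))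
    convert! h2 using 1
    ext x <;> simp
  have hQt : Filter.Tendsto Q (𝓝 0) (𝓝 0) := by
    simpa only [hQ0] using hQa.continuousAt.tendsto
  have hΨd : HasFDerivAt (fun x => Φ (Q x)) (frameMap v e e') 0 := by
    have h1 : HasFDerivAt Φ (frameMap v e e') (Q 0) := by rw [hQ0]; exact hΦd
    have h2 := h1.comp 0 hQd
    rwa [ContinuousLinearMap.comp_id] at h2
  refine ⟨fun x => Φ (Q x), F, ⟨?_, ?_, ?_, ?_, ?_, hpure⟩, fun t => -h !₂[t, 0], ?_, ?_, ?_⟩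
  · exact AnalyticAt.fun_comp (by rw [hQ0]; exact hΦa) hQa
  · simp only [hQ0, hΦ0]
  · rw [hΨd.fderiv]; exact hbij
  · have hQO : (fun x => (Q x, Q (x.1, 0))) =O[𝓝 0] fun x => ‖x‖ := by
      have h1 : Q =O[𝓝 0] fun x => ‖x‖ := by
        simpa [hQ0] using hQa.differentiableAt.isBigO_sub.norm_right
      have h2 : Filter.Tendsto (fun x : EuclideanSpace ℂ (Fin 2) × ℂ => (x.1, (0 : ℂ)))
          (𝓝 0) (𝓝 0) := Continuous.tendsto' (by fun_prop) _ _ rfl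
      refine h1.prod_left ((h1.comp_tendsto h2).trans (Asymptotics.IsBigO.of_bound 1
        (Filter.Eventually.of_forall fun x => ?_)))
      simpa using norm_fst_le x
    have ht : Filter.Tendsto (fun x => (Q x, Q (x.1, 0))) (𝓝 0) (𝓝 0) :=
      hQO.trans_tendsto
        (by simpa using (continuous_norm.tendsto (0 : EuclideanSpace ℂ (Fin 2) × ℂ)))
    refine ((hlip.comp_tendsto ht).trans (g := _) (k := fun x => ‖x‖ * ‖x.2‖)
      (hQO.norm_left.mul (Asymptotics.IsBigO.of_bound 1
        (Filter.Eventually.of_forall fun x => ?_)))).congr_left fun x => ?_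
    · simp [Q]
    · simp only [Function.comp_apply, hdr]
      simp [Q]
  · simpa [Q] using hF
  · have h1 : AnalyticAt ℂ (fun t : ℂ => (!₂[t, 0] : EuclideanSpace ℂ (Fin 2))) 0 := by
      have : (fun t : ℂ => (!₂[t, 0] : EuclideanSpace ℂ (Fin 2))) =
          (ContinuousLinearMap.id ℂ ℂ).smulRight (!₂[1, 0] : EuclideanSpace ℂ (Fin 2)) := by
        ext t i; fin_cases i <;> simp
      rw [this]
      exact ContinuousLinearMap.analyticAt _ _
    have h2 : (!₂[0, 0] : EuclideanSpace ℂ (Fin 2)) = 0 := by ext i; fin_cases i <;> rfl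
    exact (AnalyticAt.fun_comp (by rw [h2]; exact hha) h1).neg
  · have h2 : (!₂[0, 0] : EuclideanSpace ℂ (Fin 2)) = 0 := by ext i; fin_cases i <;> rfl
    simp [h2, hh0]
  · have hV : ∀ᶠ x in 𝓝 0, Φ x ∈ V ↔ x.1 1 = 0 ∧ x.2 = 0 := by
      obtain ⟨Θ, hΘa, hΘ0, hΘΦ, -⟩ := exists_analytic_local_inverse hΦa hΦ0
        (by rw [hΦd.fderiv]; exact hbij)
      have hΦt : Filter.Tendsto Φ (𝓝 0) (𝓝 0) := by
        simpa only [hΦ0] using hΦa.continuousAt.tendsto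
      let ι : ℂ → EuclideanSpace ℂ (Fin 2) × ℂ := fun t => (!₂[t, 0], 0)
      have hι : Filter.Tendsto ι (𝓝 0) (𝓝 0) := by
        have h2 : (!₂[0, 0] : EuclideanSpace ℂ (Fin 2)) = 0 := by ext i; fin_cases i <;> rfl
        exact Continuous.tendsto' (by fun_prop) _ _ (by simp [ι, h2])
      have hΦι (t) : Φ (ι t) = γ t := by simp [Φ, ι]
      have h1 : ∀ᶠ t in 𝓝 0, Θ (γ t) = ι t :=
        (hι.eventually hΘΦ).mono fun t ht => by rwa [hΦι] at ht
      -- The equality of filters makes every point of `V` near `0` a value `γ t` at a parameter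
      -- where `Θ` inverts `Φ`; this excludes other branches of `V` near `0`.
      have h2 : γ '' {t | Θ (γ t) = ι t} ∈ 𝓝[V] (0 : EuclideanSpace ℂ (Fin 3)) := by
        rw [← hmap]
        exact Filter.image_mem_map h1
      have h3 := hΦt.eventually (mem_nhdsWithin_iff_eventually.1 h2)
      have h4 : ∀ᶠ t in 𝓝 (0 : ℂ), γ t ∈ V := by
        have : V ∈ Filter.map γ (𝓝 0) := by rw [hmap]; exact self_mem_nhdsWithin
        exact this
      have h5 : Filter.Tendsto (fun x : EuclideanSpace ℂ (Fin 2) × ℂ => x.1 0) (𝓝 0) (𝓝 0) :=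
        Continuous.tendsto' (by fun_prop) _ _ rfl
      filter_upwards [h3, hΘΦ, h5.eventually h4] with x hx1 hx2 hx3
      constructor
      · intro hx
        obtain ⟨t, ht, htx⟩ := hx1 hx
        have ht : Θ (γ t) = ι t := ht
        rw [htx, hx2] at ht
        rw [ht]
        simp [ι]
      · rintro ⟨hx, hx'⟩
        simpa [Φ, hx, hx'] using hx3
    filter_upwards [hQt.eventually hV] with x hx
    rw [hx]
    refine and_congr_right fun hx1 => ?_
    have : (!₂[x.1 0, 0] : EuclideanSpace ℂ (Fin 2)) = x.1 := by
      ext i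
      fin_cases i
      · rfl
      · exact hx1.symm
    rw [this, eq_neg_iff_add_eq_zero]

/-! ### Contact orders read in pure-free coordinates -/

section Coordinates
variable {R : EuclideanSpace ℂ (Fin 3) → ℝ} {n : ℕ}
  {Ψ : EuclideanSpace ℂ (Fin 2) × ℂ → EuclideanSpace ℂ (Fin 3)}
  {F : ℕ × ℕ → EuclideanSpace ℂ (Fin 2) → ℂ}

/-- Along `(σ, h)` the function `R` is `Re h + R(Ψ(σ, 0)) + O(|z||h|)`, which is the situation of
`re_cancellation`. Only `h` has to be holomorphic. -/
theorem IsPureFreeCoordinates.curve (hΨ : IsPureFreeCoordinates R n Ψ F)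
    {σ : ℂ → EuclideanSpace ℂ (Fin 2)} (hσ : σ =O[𝓝 0] fun z => ‖z‖) {h : ℂ → ℂ}
    (hh : AnalyticAt ℂ h 0) (h0 : h 0 = 0) {c : ℕ × ℕ → ℂ} (hc : ∀ p, c (p, 0) = 0) {k : ℕ}
    (h1 : (fun z => R (Ψ (σ z, h z))) =O[𝓝 0] fun z => ‖z‖ ^ k)
    (h2 : (fun z => (R (Ψ (σ z, 0)) : ℂ) - ∑ j ∈ Finset.range k, ∑ x ∈ antidiagonal j,
      c x * z ^ x.1 * starRingEnd ℂ z ^ x.2) =O[𝓝 0] fun z => ‖z‖ ^ k) :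
    (h =O[𝓝 0] fun z => ‖z‖ ^ k) ∧ ∀ x, x.1 + x.2 < k → c x = 0 := by
  have hhO : h =O[𝓝 0] fun z => ‖z‖ := by
    simpa [h0] using hh.differentiableAt.isBigO_sub.norm_right
  have hpO : (fun z => (σ z, h z)) =O[𝓝 0] fun z => ‖z‖ := hσ.prod_left hhO
  have ht : Filter.Tendsto (fun z => (σ z, h z)) (𝓝 0) (𝓝 0) :=
    hpO.trans_tendsto (by simpa using continuous_norm.tendsto (0 : ℂ))
  let e : ℂ → ℂ := fun z =>
    ((R (Ψ (σ z, h z)) - R (Ψ (σ z, 0)) - (h z).re : ℝ) : ℂ)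
  have he : e =O[𝓝 0] fun z => ‖z‖ * ‖h z‖ :=
    Complex.isBigO_ofReal_left.2 ((hΨ.isBigO.comp_tendsto ht).trans
      (hpO.norm_left.mul (Asymptotics.isBigO_refl _ _)))
  refine re_cancellation hh h0 hc he ?_
  refine ((Complex.isBigO_ofReal_left.2 h1).sub h2).congr_left fun z => ?_
  simp only [e]
  push_cast
  ring

/-- `V` is the curve `(t, 0, g(t))`, and on the axis each component is `F x e₁ * t ^ p * t̄ ^ q`.
The contact of `V` therefore bounds `g` and kills the coefficients of degree below `η`, which
carries the contact over to the axis itself. -/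
theorem IsPureFreeCoordinates.isBigO_of_contact {η : ℕ} (hη : 1 ≤ η)
    (hΨ : IsPureFreeCoordinates R η Ψ F) {V : Set (EuclideanSpace ℂ (Fin 3))}
    (hcontact : ∃ C : ℝ, ∀ᶠ w in 𝓝[V] (0 : EuclideanSpace ℂ (Fin 3)), |R w| ≤ C * ‖w‖ ^ η)
    {g : ℂ → ℂ} (hg : AnalyticAt ℂ g 0) (hg0 : g 0 = 0)
    (hgV : ∀ᶠ x in 𝓝 0, Ψ x ∈ V ↔ x.1 1 = 0 ∧ x.2 = g (x.1 0)) :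
    (g =O[𝓝 0] fun t => ‖t‖ ^ η) ∧
      (fun t : ℂ => R (Ψ (!₂[t, 0], 0))) =O[𝓝 0] fun t => ‖t‖ ^ η := by
  obtain ⟨k, rfl⟩ := Nat.exists_eq_add_of_le' hη
  obtain ⟨C, hC⟩ := hcontact
  let e₁ : EuclideanSpace ℂ (Fin 2) := !₂[1, 0]
  have hs (t : ℂ) : (!₂[t, 0] : EuclideanSpace ℂ (Fin 2)) = t • e₁ := by
    ext i; fin_cases i <;> simp [e₁]
  have hσ : (fun t : ℂ => (!₂[t, 0] : EuclideanSpace ℂ (Fin 2))) =O[𝓝 0] fun t => ‖t‖ := by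
    refine Asymptotics.IsBigO.of_bound ‖e₁‖ (Filter.Eventually.of_forall fun t => ?_)
    rw [hs, norm_smul, norm_norm, mul_comm]
  have hgO : g =O[𝓝 0] fun z => ‖z‖ := by
    simpa [hg0] using hg.differentiableAt.isBigO_sub.norm_right
  have hpO : (fun z : ℂ => ((!₂[z, 0] : EuclideanSpace ℂ (Fin 2)), g z)) =O[𝓝 0]
    fun z => ‖z‖ := hσ.prod_left hgO
  have ht : Filter.Tendsto (fun z : ℂ => ((!₂[z, 0] : EuclideanSpace ℂ (Fin 2)), g z))
      (𝓝 0) (𝓝 0) := hpO.trans_tendsto (by simpa using continuous_norm.tendsto (0 : ℂ))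
  have hΨO : Ψ =O[𝓝 0] fun x => ‖x‖ := by
    simpa [hΨ.map_zero] using hΨ.analyticAt.differentiableAt.isBigO_sub.norm_right
  have hΨt : Filter.Tendsto Ψ (𝓝 0) (𝓝 0) := by
    simpa only [hΨ.map_zero] using hΨ.analyticAt.continuousAt.tendsto
  have h1 : (fun z : ℂ => R (Ψ (!₂[z, 0], g z))) =O[𝓝 0] fun z => ‖z‖ ^ (k + 1) := by
    refine Asymptotics.IsBigO.trans (Asymptotics.IsBigO.of_bound C ?_)
      (((hΨO.comp_tendsto ht).trans hpO.norm_left).norm_left.pow (k + 1))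
    filter_upwards [ht.eventually hgV,
      ht.eventually (hΨt.eventually (eventually_nhdsWithin_iff.1 hC))] with z hz1 hz2
    simpa using hz2 (hz1.2 (by simp))
  have hjet := hΨ.isJet.mono (Nat.le_succ k)
  have hj : (fun z : ℂ => (R (Ψ (!₂[z, 0], 0)) : ℂ) - ∑ j ∈ Finset.range (k + 1),
      ∑ x ∈ antidiagonal j, F x e₁ * z ^ x.1 * starRingEnd ℂ z ^ x.2) =O[𝓝 0]
        fun z => ‖z‖ ^ (k + 1) := by
    have ht' : Filter.Tendsto (fun z : ℂ => (!₂[z, 0] : EuclideanSpace ℂ (Fin 2)))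
      (𝓝 0) (𝓝 0) := hσ.trans_tendsto (by simpa using continuous_norm.tendsto (0 : ℂ))
    refine ((hjet.isBigO.comp_tendsto ht').trans (hσ.norm_left.pow (k + 1))).congr_left fun z => ?_
    simp only [Function.comp_apply, jetSum]
    congr 1
    refine Finset.sum_congr rfl fun j _ => Finset.sum_congr rfl fun x _ => ?_
    rw [hs, bihomogeneous_smul (hjet.mem x)]
    ring
  obtain ⟨h2, h3⟩ := hΨ.curve hσ hg hg0
    (fun p => by rw [hΨ.pure (p, 0) (Or.inr rfl)]; rfl) h1 hj
  refine ⟨h2, Complex.isBigO_ofReal_left.1 (hj.congr_left fun z => ?_)⟩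
  rw [sub_eq_self]
  refine Finset.sum_eq_zero fun j hj => Finset.sum_eq_zero fun x hx => ?_
  rw [h3 x (by rw [mem_antidiagonal.1 hx]; exact Finset.mem_range.1 hj)]
  ring

theorem exists_eq_smul_analyticAt {E : Type*} [NormedAddCommGroup E] [NormedSpace ℂ E]
    {σ : ℂ → E} {v : E} (hσ : AnalyticAt ℂ σ 0) (h0 : σ 0 = 0) (hd : HasDerivAt σ v 0) :
    ∃ τ : ℂ → E, AnalyticAt ℂ τ 0 ∧ τ 0 = v ∧ ∀ᶠ z in 𝓝 0, σ z = z • τ z := by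
  have h1 : ((1 : ℕ) : ℕ∞) ≤ analyticOrderAt σ 0 := by
    rw [Nat.cast_one, Order.one_le_iff_ne_zero]
    exact hσ.analyticOrderAt_ne_zero.2 h0
  obtain ⟨τ, hτ, hστ⟩ := (natCast_le_analyticOrderAt hσ).1 h1
  simp only [sub_zero, pow_one] at hστ
  refine ⟨τ, hτ, ?_, hστ⟩
  have h2 := (hasDerivAt_id (0 : ℂ)).smul hτ.differentiableAt.hasDerivAt
  simp only [id_eq, zero_smul, one_smul, zero_add] at h2
  exact (h2.congr_of_eventuallyEq hστ).unique hd

/-- Write `σ(z) = z τ(z)` with `τ(0) = v`. By bihomogeneity the layer of degree `k` along `σ` is `∑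
F x v * z ^ p * z̄ ^ q` up to `O(|z| ^ (k + 1))`, so only the tangent vector `v` matters. -/
theorem IsPureFreeCoordinates.contact_step (hΨ : IsPureFreeCoordinates R n Ψ F) {k : ℕ}
    (hkn : k ≤ n) (hF : ∀ x, x.1 + x.2 < k → F x = 0)
    {σ : ℂ → EuclideanSpace ℂ (Fin 2)} (hσ : AnalyticAt ℂ σ 0) (hσ0 : σ 0 = 0)
    {v : EuclideanSpace ℂ (Fin 2)} (hv : HasDerivAt σ v 0)
    {h : ℂ → ℂ} (hh : AnalyticAt ℂ h 0) (h0 : h 0 = 0)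
    (hR : (fun z => R (Ψ (σ z, h z))) =O[𝓝 0] fun z => ‖z‖ ^ (k + 1)) :
    (h =O[𝓝 0] fun z => ‖z‖ ^ (k + 1)) ∧ ∀ x, x.1 + x.2 = k → F x v = 0 := by
  obtain ⟨τ, hτ, rfl, hστ⟩ := exists_eq_smul_analyticAt hσ hσ0 hv
  have hσO : σ =O[𝓝 0] fun z => ‖z‖ := by
    simpa [hσ0] using hσ.differentiableAt.isBigO_sub.norm_right
  have ht : Filter.Tendsto σ (𝓝 0) (𝓝 0) :=
    hσO.trans_tendsto (by simpa using continuous_norm.tendsto (0 : ℂ))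
  have hjet := hΨ.isJet.mono hkn
  have h1 : ∀ x ∈ antidiagonal k, (fun z => F x (σ z) -
      F x (τ 0) * z ^ x.1 * starRingEnd ℂ z ^ x.2) =O[𝓝 0] fun z => ‖z‖ ^ (k + 1) := by
    intro x hx
    have hd : DifferentiableAt ℝ (fun z => F x (τ z)) 0 :=
      ((contDiff_of_mem_bihomogeneous (hjet.mem x)).differentiable (by simp)
        (τ 0)).comp 0 (hτ.differentiableAt.restrictScalars ℝ)
    have h2 : (fun z : ℂ => z ^ x.1 * starRingEnd ℂ z ^ x.2) =O[𝓝 0] fun z => ‖z‖ ^ k := by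
      refine Asymptotics.IsBigO.of_bound 1 (Filter.Eventually.of_forall fun z => ?_)
      rw [← mem_antidiagonal.1 hx]
      simp [pow_add]
    refine Filter.EventuallyEq.trans_isBigO (hστ.mono fun z hz => ?_)
      ((h2.mul hd.isBigO_sub.norm_right).congr_right fun z => ?_)
    · simp only [hz, bihomogeneous_smul (hjet.mem x)]
      ring
    · rw [sub_zero, pow_succ]
  have h2 := hΨ.curve (c := fun x => F x (τ 0)) (k := k + 1) hσO hh h0
    (fun p => by simp only [hΨ.pure (p, 0) (Or.inr rfl), Pi.zero_apply]) hR (by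
      refine (((hjet.isBigO.comp_tendsto ht).trans (hσO.norm_left.pow (k + 1))).add
        (Asymptotics.IsBigO.fun_sum h1)).congr_left fun z => ?_
      have h3 (c : ℕ × ℕ → ℂ) (hc : ∀ x, x.1 + x.2 < k → c x = 0) :
          ∑ j ∈ Finset.range (k + 1), ∑ x ∈ antidiagonal j, c x = ∑ x ∈ antidiagonal k, c x := by
        rw [Finset.sum_range_succ, add_eq_right]
        refine Finset.sum_eq_zero fun j hj => Finset.sum_eq_zero fun x hx => hc x ?_
        rw [mem_antidiagonal.1 hx]
        exact Finset.mem_range.1 hj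
      simp only [Function.comp_apply, jetSum, Finset.sum_sub_distrib]
      rw [h3 _ fun x hx => by rw [hF x hx]; rfl, h3 _ fun x hx => by rw [hF x hx]; simp]
      ring)
  exact ⟨h2.1, fun x hx => h2.2 x (by omega)⟩

/-- Pull a surface of contact `m` back to `χ` in the coordinates and restrict it to complex lines.
By induction on the degree `k < m`, `contact_step` makes the components of degree `k` vanish on the
range of the `u`-part of `dχ(0)`. For `k ≥ 1` it also makes the `s`-part of `dχ(0)` zero, so
injectivity of `dχ(0)` forces its `u`-part to be onto `ℂ²`. Degree `0` is pure. -/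
theorem IsPureFreeCoordinates.eq_zero_of_lt {m : ℕ} (hΨ : IsPureFreeCoordinates R n Ψ F)
    (hmn : m ≤ n) (hm : bloomGrahamType R 0 = m) (x : ℕ × ℕ) (hx : x.1 + x.2 < m) : F x = 0 := by
  obtain ⟨j, rfl⟩ : ∃ j, m = j + 1 := ⟨m - 1, by omega⟩
  obtain ⟨φ, hφ, hφO⟩ := exists_contact_of_lt_bloomGrahamType (k := j) (R := R) (p := 0)
    (by rw [hm]; exact_mod_cast Nat.lt_succ_self j)
  obtain ⟨Θ, hΘ, hΘ0, -, hΘr⟩ := exists_analytic_local_inverse hΨ.analyticAt hΨ.map_zero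
    hΨ.bijective_fderiv
  have hφt : Filter.Tendsto φ (𝓝 0) (𝓝 0) := by
    simpa only [hφ.map_zero] using hφ.analyticAt.continuousAt.tendsto
  let χ : EuclideanSpace ℂ (Fin 2) → EuclideanSpace ℂ (Fin 2) × ℂ := fun ζ => Θ (φ ζ)
  have hχ : AnalyticAt ℂ χ 0 := AnalyticAt.fun_comp (by rw [hφ.map_zero]; exact hΘ) hφ.analyticAt
  have hχ0 : χ 0 = 0 := by simp only [χ, hφ.map_zero, hΘ0]
  have hΨχ : ∀ᶠ ζ in 𝓝 0, Ψ (χ ζ) = φ ζ := hφt.eventually hΘr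
  set D := fderiv ℂ χ 0 with hD
  have hχd : HasFDerivAt χ D 0 := hχ.differentiableAt.hasFDerivAt
  have hDinj : Function.Injective D := by
    have h1 : HasFDerivAt Ψ (fderiv ℂ Ψ 0) (χ 0) := by
      rw [hχ0]; exact hΨ.analyticAt.differentiableAt.hasFDerivAt
    have h2 := ((h1.comp 0 hχd).congr_of_eventuallyEq (hΨχ.mono fun ζ h => h.symm)).fderiv
    have h3 := hφ.injective_fderiv
    rw [h2] at h3
    exact Function.Injective.of_comp h3
  have key (k : ℕ) (hk : k < j + 1) (hF : ∀ x, x.1 + x.2 < k → F x = 0)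
      (ζ : EuclideanSpace ℂ (Fin 2)) :
      ((fun z : ℂ => (χ (z • ζ)).2) =O[𝓝 0] fun z => ‖z‖ ^ (k + 1)) ∧
        ∀ x, x.1 + x.2 = k → F x (D ζ).1 = 0 := by
    let L : ℂ →L[ℂ] EuclideanSpace ℂ (Fin 2) := (ContinuousLinearMap.id ℂ ℂ).smulRight ζ
    have hLa : AnalyticAt ℂ (fun z => χ (L z)) 0 :=
      AnalyticAt.fun_comp (by rw [_root_.map_zero]; exact hχ) (L.analyticAt 0)
    have hLt : Filter.Tendsto L (𝓝 0) (𝓝 0) := L.continuous.tendsto' 0 0 (_root_.map_zero L)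
    have hLd : HasDerivAt (fun z => χ (L z)) (D ζ) 0 := by
      have h1 : HasFDerivAt χ D (L 0) := by rw [_root_.map_zero]; exact hχd
      exact (h1.comp 0 L.hasFDerivAt).hasDerivAt.congr_deriv (by simp [L])
    have h0 : χ (L 0) = 0 := by rw [_root_.map_zero, hχ0]
    have hR : (fun z : ℂ => R (Ψ (χ (L z)))) =O[𝓝 0] fun z => ‖z‖ ^ (k + 1) := by
      have h1 : (fun z => R (φ (L z))) =O[𝓝 0] fun z => ‖z‖ ^ (j + 1) :=
        (hφO.comp_tendsto hLt).trans ((L.isBigO_id (𝓝 0)).norm_left.norm_right.pow (j + 1))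
      refine Filter.EventuallyEq.trans_isBigO
        ((hLt.eventually hΨχ).mono fun z hz => ?_) (h1.trans (isBigO_norm_pow_of_le hk))
      simp only [hz]
    have hfst : AnalyticAt ℂ (fun z => (χ (L z)).1) 0 :=
      AnalyticAt.fun_comp (g := Prod.fst) analyticAt_fst hLa
    have hsnd : AnalyticAt ℂ (fun z => (χ (L z)).2) 0 :=
      AnalyticAt.fun_comp (g := Prod.snd) analyticAt_snd hLa
    exact hΨ.contact_step (by omega) hF hfst (congrArg Prod.fst h0)
      (hLd.hasFDerivAt.fst.hasDerivAt.congr_deriv (by simp)) hsnd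
      (congrArg Prod.snd h0) hR
  have hsurj (k : ℕ) (hk0 : 1 ≤ k) (hk : k < j + 1) (hF : ∀ x, x.1 + x.2 < k → F x = 0) :
      Function.Surjective fun ζ => (D ζ).1 := by
    have h1 (ζ) : (D ζ).2 = 0 := by
      -- Here `1 ≤ k` matters: order `k + 1 ≥ 2` is what annihilates the derivative of the
      -- `s`-component.
      have h2 := (key k hk hF ζ).1.trans (isBigO_norm_pow_of_le (b := k + 1) (a := 2) (by omega))
      have h3 : HasDerivAt (fun z : ℂ => (χ (z • ζ)).2) (D ζ).2 0 := by
        have h1 : HasFDerivAt χ D ((0 : ℂ) • ζ) := by rw [zero_smul]; exact hχd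
        have h4 : HasDerivAt (fun z : ℂ => z • ζ) ζ 0 := by
          simpa using (hasDerivAt_id (0 : ℂ)).smul_const ζ
        exact (h1.comp_hasDerivAt 0 h4).hasFDerivAt.snd.hasDerivAt.congr_deriv (by simp)
      have h4 : HasDerivAt (fun z : ℂ => (χ (z • ζ)).2) 0 0 := by
        have h5 : (χ ((0 : ℂ) • ζ)).2 = 0 := by rw [zero_smul, hχ0]; rfl
        refine HasFDerivAt.hasDerivAt (f' := (0 : ℂ →L[ℂ] ℂ)) (HasFDerivAt.of_isLittleO ?_)
        simp only [h5, sub_zero, zero_apply]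
        exact h2.trans_isLittleO (Asymptotics.isLittleO_norm_pow_id (E' := ℂ) one_lt_two)
      exact h3.unique h4
    let L : EuclideanSpace ℂ (Fin 2) →ₗ[ℂ] EuclideanSpace ℂ (Fin 2) :=
      (LinearMap.fst ℂ _ ℂ).comp (D : EuclideanSpace ℂ (Fin 2) →ₗ[ℂ] EuclideanSpace ℂ (Fin 2) × ℂ)
    have hL : Function.Injective L := fun a b hab =>
      hDinj (Prod.ext hab ((h1 a).trans (h1 b).symm))
    exact LinearMap.injective_iff_surjective.1 hL
  have hall : ∀ k < j + 1, ∀ x : ℕ × ℕ, x.1 + x.2 = k → F x = 0 := by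
    intro k
    induction k using Nat.strong_induction_on with
    | _ k ih =>
      intro hk x hx
      have hF : ∀ x : ℕ × ℕ, x.1 + x.2 < k → F x = 0 :=
        fun x hx => ih _ hx (by omega) x rfl
      rcases Nat.eq_zero_or_pos k with rfl | hk0
      · exact hΨ.pure x (by omega)
      · ext u
        obtain ⟨ζ, rfl⟩ := hsurj k hk0 hk hF u
        exact (key k hk hF ζ).2 x hx
  exact hall _ hx x rfl

/-- If the layer of degree `m` vanished too, the surface `s = 0` would have contact `m + 1`,
exceeding the type. -/
theorem IsPureFreeCoordinates.exists_ne_zero {m : ℕ} (hΨ : IsPureFreeCoordinates R n Ψ F)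
    (hmn : m ≤ n) (hm : bloomGrahamType R 0 = m) : ∃ x : ℕ × ℕ, x.1 + x.2 = m ∧ F x ≠ 0 := by
  by_contra! h
  have h1 : (fun u => (R (Ψ (u, 0)) : ℂ)) =O[𝓝 0] fun u => ‖u‖ ^ (m + 1) := by
    refine (hΨ.isJet.mono hmn).isBigO.congr_left fun u => ?_
    rw [sub_eq_self]
    refine Finset.sum_eq_zero fun k hk => Finset.sum_eq_zero fun x hx => ?_
    have hx := mem_antidiagonal.1 hx
    have hk := Finset.mem_range.1 hk
    rcases Nat.lt_or_ge (x.1 + x.2) m with hlt | hle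
    · rw [hΨ.eq_zero_of_lt hmn hm x hlt]; rfl
    · rw [h x (by omega)]; rfl
  have h2 : IsSubmanifoldParam (fun u => Ψ (u, 0)) 0 := by
    let ι := ContinuousLinearMap.inl ℂ (EuclideanSpace ℂ (Fin 2)) ℂ
    have h3 : HasFDerivAt Ψ (fderiv ℂ Ψ 0) (ι 0) := by
      rw [_root_.map_zero]; exact hΨ.analyticAt.differentiableAt.hasFDerivAt
    refine ⟨AnalyticAt.fun_comp (g := Ψ) (f := ι) (by rw [_root_.map_zero]; exact hΨ.analyticAt)
      (ι.analyticAt 0), hΨ.map_zero, ?_⟩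
    have h4 := (h3.comp 0 ι.hasFDerivAt).fderiv
    have h5 : fderiv ℂ (fun u => Ψ (u, 0)) 0 = _ := h4
    rw [h5]
    exact hΨ.bijective_fderiv.1.comp (Prod.mk_left_injective (0 : ℂ))
  have h3 := natCast_le_bloomGrahamType h2 (Complex.isBigO_ofReal_left.1 h1)
  rw [hm] at h3
  have : m + 1 ≤ m := by exact_mod_cast h3
  omega

end Coordinates

/-! ### The shear and the monomial coefficients -/

/-- The shear `(u₁, u₂) ↦ (u₁ + c u₂, u₂)`. -/
noncomputable def shear (c : ℂ) : EuclideanSpace ℂ (Fin 2) →L[ℂ] EuclideanSpace ℂ (Fin 2) :=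
  (EuclideanSpace.proj (0 : Fin 2) + c • EuclideanSpace.proj (1 : Fin 2) :
      EuclideanSpace ℂ (Fin 2) →L[ℂ] ℂ).smulRight !₂[1, 0] +
    (EuclideanSpace.proj (1 : Fin 2) : EuclideanSpace ℂ (Fin 2) →L[ℂ] ℂ).smulRight !₂[0, 1]

theorem shear_apply (c : ℂ) (u : EuclideanSpace ℂ (Fin 2)) :
    shear c u = !₂[u 0 + c * u 1, u 1] := by
  ext i; fin_cases i <;> simp [shear]

/-- The linear map `z ↦ ((z₁ + c z₂, z₂), z₃)`. -/
noncomputable def shearSplit (c : ℂ) :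
    EuclideanSpace ℂ (Fin 3) →L[ℂ] EuclideanSpace ℂ (Fin 2) × ℂ :=
  ((shear c).comp
    ((EuclideanSpace.proj (0 : Fin 3) : EuclideanSpace ℂ (Fin 3) →L[ℂ] ℂ).smulRight !₂[1, 0] +
      (EuclideanSpace.proj (1 : Fin 3) : EuclideanSpace ℂ (Fin 3) →L[ℂ] ℂ).smulRight
        !₂[0, 1])).prod (EuclideanSpace.proj (2 : Fin 3))

theorem shearSplit_apply (c : ℂ) (z : EuclideanSpace ℂ (Fin 3)) :
    shearSplit c z = (shear c (firstTwo z), z 2) := by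
  refine Prod.ext ?_ rfl
  change shear c _ = shear c _
  congr 1
  ext i; fin_cases i <;> simp [firstTwo]

theorem shearSplit_bijective (c : ℂ) : Function.Bijective (shearSplit c) := by
  have h : Function.Injective (shearSplit c) := by
    rw [injective_iff_map_eq_zero]
    intro z hz
    rw [shearSplit_apply, shear_apply, Prod.mk_eq_zero] at hz
    have h0 := congrArg (fun u : EuclideanSpace ℂ (Fin 2) => u 0) hz.1
    have h1 := congrArg (fun u : EuclideanSpace ℂ (Fin 2) => u 1) hz.1
    simp only [firstTwo, PiLp.zero_apply] at h0 h1
    have h1 : z 1 = 0 := by simpa using h1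
    have h0 : z 0 = 0 := by simpa [h1] using h0
    ext i
    fin_cases i
    · exact h0
    · exact h1
    · exact hz.2
  exact ⟨h, (LinearMap.injective_iff_surjective_of_finrank_eq_finrank
    (f := (shearSplit c : EuclideanSpace ℂ (Fin 3) →ₗ[ℂ] EuclideanSpace ℂ (Fin 2) × ℂ))
    (by simp)).1 h⟩

/-- By scaling, vanishing at all `(c, 1)` means vanishing wherever `u₂ ≠ 0`, hence everywhere by
density. -/
theorem exists_shear_ne_zero {p q : ℕ} {F : EuclideanSpace ℂ (Fin 2) → ℂ}
    (hF : F ∈ bihomogeneous p q) (h0 : F ≠ 0) : ∃ c : ℂ, F !₂[c, 1] ≠ 0 := by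
  by_contra! h
  have h1 (u : EuclideanSpace ℂ (Fin 2)) (hu : u 1 ≠ 0) : F u = 0 := by
    have h2 : u = u 1 • !₂[u 0 / u 1, 1] := by
      ext i; fin_cases i
      · simp [mul_div_cancel₀ _ hu]
      · simp
    rw [h2, bihomogeneous_smul hF, h, mul_zero]
  refine h0 (funext fun u => ?_)
  by_cases hu : u 1 = 0
  · let f : ℂ → ℂ := fun t => F (u + t • !₂[0, 1])
    have hf : Continuous f := (contDiff_of_mem_bihomogeneous hF).continuous.comp (by fun_prop)
    have h2 : f = fun _ => 0 := by
      refine Continuous.ext_on (dense_compl_singleton (0 : ℂ)) hf continuous_const fun t ht => ?_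
      exact h1 _ (by simpa [hu] using ht)
    simpa [f] using congrFun h2 0
  · exact h1 u hu

/-- A monomial determines its bidegree, so the separate expansions fit into one array `a`.
Characterizing `s` by membership lets the fibres of `mixedIndices` be used directly. -/
theorem exists_coefficients {F : ℕ × ℕ → EuclideanSpace ℂ (Fin 2) → ℂ}
    (hF : ∀ x, F x ∈ bihomogeneous x.1 x.2) :
    ∃ a : (Fin 2 → ℕ) → (Fin 2 → ℕ) → ℂ, ∀ (x : ℕ × ℕ) (s : Finset ((Fin 2 → ℕ) × (Fin 2 → ℕ))),
      (∀ y, y ∈ s ↔ multiLength y.1 = x.1 ∧ multiLength y.2 = x.2) →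
      ∀ u, F x u = ∑ y ∈ s, a y.1 y.2 * mixedMonomial y.1 y.2 u := by
  have h1 (x : ℕ × ℕ) := (Finsupp.mem_span_image_iff_linearCombination ℂ).1 (hF x)
  choose l hl hlF using h1
  refine ⟨fun α β => l (multiLength α, multiLength β) (α, β), fun x s hs u => ?_⟩
  have h2 : (l x).support ⊆ s := fun y hy => (hs y).2 (hl x hy)
  rw [← hlF x, Finsupp.linearCombination_apply, Finsupp.sum_of_support_subset _ h2 _ (by simp),
    Finset.sum_apply]
  refine Finset.sum_congr rfl fun y hy => ?_
  obtain ⟨h3, h4⟩ := (hs y).1 hy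
  simp only [h3, h4]
  rfl

theorem jetSum_eq_sum_mixedIndices {m η : ℕ} {F : ℕ × ℕ → EuclideanSpace ℂ (Fin 2) → ℂ}
    {a : (Fin 2 → ℕ) → (Fin 2 → ℕ) → ℂ}
    (ha : ∀ (x : ℕ × ℕ) (s : Finset ((Fin 2 → ℕ) × (Fin 2 → ℕ))),
      (∀ y, y ∈ s ↔ multiLength y.1 = x.1 ∧ multiLength y.2 = x.2) →
      ∀ u, F x u = ∑ y ∈ s, a y.1 y.2 * mixedMonomial y.1 y.2 u)
    (hpure : ∀ x : ℕ × ℕ, x.1 = 0 ∨ x.2 = 0 → x.1 + x.2 ≤ η → F x = 0)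
    (hlow : ∀ x : ℕ × ℕ, x.1 + x.2 ≤ η → x.1 + x.2 < m → F x = 0)
    (u : EuclideanSpace ℂ (Fin 2)) :
    jetSum η F u = ∑ y ∈ mixedIndices m η, a y.1 y.2 * mixedMonomial y.1 y.2 u := by
  rw [← Finset.sum_fiberwise_of_maps_to (s := mixedIndices m η) (t := Finset.range (η + 1))
    (g := fun y => multiLength y.1 + multiLength y.2)
    (fun y hy => Finset.mem_range.2 (Nat.lt_succ_of_le ((mem_mixedIndices m η y).1 hy).2.2.2))]
  refine Finset.sum_congr rfl fun k hk => ?_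
  rw [← Finset.sum_fiberwise_of_maps_to (t := antidiagonal k)
    (g := fun y : (Fin 2 → ℕ) × (Fin 2 → ℕ) => (multiLength y.1, multiLength y.2))
    (fun y hy => mem_antidiagonal.2 (Finset.mem_filter.1 hy).2)]
  refine Finset.sum_congr rfl fun x hx => ?_
  have hx := mem_antidiagonal.1 hx
  have hk := Finset.mem_range.1 hk
  by_cases h : 0 < x.1 ∧ 0 < x.2 ∧ m ≤ k
  · refine ha x _ (fun y => ?_) u
    simp only [Finset.mem_filter, mem_mixedIndices, Prod.ext_iff]
    omega
  · have h1 : F x = 0 := by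
      by_cases h2 : x.1 = 0 ∨ x.2 = 0
      · exact hpure x h2 (by omega)
      · exact hlow x (by omega) (by omega)
    rw [h1, Pi.zero_apply]
    refine (Finset.sum_eq_zero fun y hy => ?_).symm
    simp only [Finset.mem_filter, mem_mixedIndices, Prod.ext_iff] at hy
    omega

/-- At the point `(0, 1)` every monomial containing `u₁` or `ū₁` vanishes, so a single term of
bidegree `x` remains. -/
theorem coefficient_ne_zero {F : ℕ × ℕ → EuclideanSpace ℂ (Fin 2) → ℂ}
    {a : (Fin 2 → ℕ) → (Fin 2 → ℕ) → ℂ}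
    (ha : ∀ (x : ℕ × ℕ) (s : Finset ((Fin 2 → ℕ) × (Fin 2 → ℕ))),
      (∀ y, y ∈ s ↔ multiLength y.1 = x.1 ∧ multiLength y.2 = x.2) →
      ∀ u, F x u = ∑ y ∈ s, a y.1 y.2 * mixedMonomial y.1 y.2 u) {x : ℕ × ℕ}
    (hx : F x !₂[0, 1] ≠ 0) : a ![0, x.1] ![0, x.2] ≠ 0 := by
  intro h
  let s : Finset ((Fin 2 → ℕ) × (Fin 2 → ℕ)) :=
    ((Fintype.piFinset fun _ => Finset.range (x.1 + 1)) ×ˢ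
      (Fintype.piFinset fun _ => Finset.range (x.2 + 1))).filter fun y =>
        multiLength y.1 = x.1 ∧ multiLength y.2 = x.2
  have hs (y) : y ∈ s ↔ multiLength y.1 = x.1 ∧ multiLength y.2 = x.2 := by
    simp only [s, multiLength, Finset.mem_filter, Finset.mem_product, Fintype.mem_piFinset,
      Finset.mem_range, Fin.sum_univ_two, Fin.forall_fin_two]
    omega
  rw [ha x s hs] at hx
  refine hx (Finset.sum_eq_zero fun y hy => ?_)
  obtain ⟨h1, h2⟩ := (hs y).1 hy
  simp only [multiLength, Fin.sum_univ_two] at h1 h2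
  by_cases h3 : y.1 0 = 0 ∧ y.2 0 = 0
  · have h4 : y.1 = ![0, x.1] := by
      ext i; fin_cases i
      · exact h3.1
      · simp; omega
    have h5 : y.2 = ![0, x.2] := by
      ext i; fin_cases i
      · exact h3.2
      · simp; omega
    rw [h4, h5, h, zero_mul]
  · rw [not_and_or] at h3
    rcases h3 with h3 | h3 <;> simp [mixedMonomial, h3]

/-! ### Assembly of the normal form -/

theorem theorem2p1
    (Ω : Set (EuclideanSpace ℂ (Fin 3))) (R : EuclideanSpace ℂ (Fin 3) → ℝ)
    (hΩ : IsSmoothlyBoundedDomain Ω R) (hpsc : IsLeviPseudoconvex Ω R)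
    (h0 : (0 : EuclideanSpace ℂ (Fin 3)) ∈ frontier Ω)
    (m : ℕ) (hm : bloomGrahamType R 0 = (m : ℕ∞))
    (V : Set (EuclideanSpace ℂ (Fin 3))) (hV : IsSmoothCurveAt V 0)
    (η : ℕ) (hmη : m ≤ η)
    (hcontact : ∃ C : ℝ, ∀ᶠ w in 𝓝[V] (0 : EuclideanSpace ℂ (Fin 3)), |R w| ≤ C * ‖w‖ ^ η) :
    ∃ (Ψ : EuclideanSpace ℂ (Fin 3) → EuclideanSpace ℂ (Fin 3))
      (a : (Fin 2 → ℕ) → (Fin 2 → ℕ) → ℂ),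
      IsHolomorphicCoordinates Ψ ∧
      -- the normal form of `r = R ∘ Ψ`
      ((fun z : EuclideanSpace ℂ (Fin 3) =>
          ((R (Ψ z) : ℝ) : ℂ) - (((z 2).re : ℝ) : ℂ)
            - ∑ x ∈ mixedIndices m η, a x.1 x.2 * mixedMonomial x.1 x.2 (firstTwo z))
        =O[𝓝 0] fun z => ‖z 2‖ * ‖z‖ + ‖firstTwo z‖ ^ (η + 1)) ∧
      -- `V` is the `z₁`-axis to order `η`
      (∃ g : ℂ → ℂ, AnalyticAt ℂ g 0 ∧ (g =O[𝓝 0] fun t => ‖t‖ ^ η) ∧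
        ∀ᶠ z in 𝓝 (0 : EuclideanSpace ℂ (Fin 3)), Ψ z ∈ V ↔ z 1 = 0 ∧ z 2 = g (z 0)) ∧
      -- `|r(t, 0, 0)| ≲ |t| ^ η`
      ((fun t : ℂ => R (Ψ !₂[t, 0, 0])) =O[𝓝 0] fun t => ‖t‖ ^ η) ∧
      -- a nonzero mixed term of degree `m` in `z₂`
      ∃ α₂ β₂ : ℕ, 0 < α₂ ∧ 0 < β₂ ∧ α₂ + β₂ = m ∧ a ![0, α₂] ![0, β₂] ≠ 0 := by
  have hR := hΩ.contDiff
  have hR0 : R 0 = 0 := by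
    rw [hΩ.eq_sublevel] at h0
    exact frontier_lt_subset_eq hR.continuous continuous_const h0
  -- This gives `η ≥ 2`, which makes `V` tangent to the boundary.
  have hm2 : 2 ≤ m := by
    have := two_le_bloomGrahamType hR hR0
    rw [hm] at this
    exact_mod_cast this
  obtain ⟨Ψ, F, hΨ, g, hg, hg0, hgV⟩ := exists_isPureFreeCoordinates hR hR0
    (hΩ.fderiv_ne_zero 0 h0) hV (hm2.trans hmη) hcontact
  obtain ⟨hgO, hΨO⟩ := hΨ.isBigO_of_contact (by omega) hcontact hg hg0 hgV
  obtain ⟨x, hxm, hx⟩ := hΨ.exists_ne_zero hmη hm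
  have hx1 : x.1 ≠ 0 := fun h => hx (hΨ.pure x (Or.inl h))
  have hx2 : x.2 ≠ 0 := fun h => hx (hΨ.pure x (Or.inr h))
  obtain ⟨c, hc⟩ := exists_shear_ne_zero (hΨ.isJet.mem x) hx
  let T := shear c
  have hsmooth : ContDiffAt ℝ ∞ (fun u => (R (Ψ (T u, 0)) : ℂ)) 0 := by
    let ι := (ContinuousLinearMap.inl ℂ (EuclideanSpace ℂ (Fin 2)) ℂ).comp T
    have h1 : ContDiffAt ℝ ∞ (fun u => Ψ (ι u)) 0 := by
      have : AnalyticAt ℂ (fun u => Ψ (ι u)) 0 :=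
        AnalyticAt.fun_comp (by rw [map_zero]; exact hΨ.analyticAt) (ι.analyticAt 0)
      exact (this.contDiffAt (n := ∞)).restrict_scalars ℝ
    exact Complex.ofRealCLM.contDiff.contDiffAt.comp 0 (hR.contDiffAt.comp 0 h1)
  obtain ⟨G, hG⟩ := exists_isJet hsmooth η
  -- The jet is taken afresh after the shear and identified with the sheared components by
  -- uniqueness, so no monomial is expanded under `T`; vanishing of components carries over up to
  -- degree `η`.
  have hGF : ∀ x : ℕ × ℕ, x.1 + x.2 ≤ η → ∀ u, G x u = F x (T u) := by
    have h1 := eq_zero_of_isBigO_jetSum (n := η) (F := G - fun x u => F x (T u))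
      (fun x => (isBihomogeneous_of_mem (hG.mem x)).sub
        ((isBihomogeneous_of_mem (hΨ.isJet.mem x)).comp_clm T)) (by
        refine ((isBigO_clm_comp hΨ.isJet.isBigO T).sub hG.isBigO).congr_left fun u => ?_
        rw [jetSum_sub]
        simp only [jetSum]
        ring)
    exact fun x hx u => sub_eq_zero.1 (congrFun (h1 x hx) u)
  obtain ⟨a, ha⟩ := exists_coefficients hG.mem
  have hsum := jetSum_eq_sum_mixedIndices (m := m) (η := η) ha
    (fun x hx hxη => funext fun u => by rw [hGF x hxη, hΨ.pure x hx]; rfl)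
    (fun x hxη hx => funext fun u => by rw [hGF x hxη, hΨ.eq_zero_of_lt hmη hm x hx]; rfl)
  let A := shearSplit c
  have hA (z) : A z = (T (firstTwo z), z 2) := shearSplit_apply c z
  have hAt : Filter.Tendsto A (𝓝 0) (𝓝 0) := A.continuous.tendsto' 0 0 (map_zero A)
  refine ⟨fun z => Ψ (A z), a, ⟨?_, ?_, ?_⟩, ?_, ⟨g, hg, hgO, ?_⟩, ?_,
    x.1, x.2, by omega, by omega, hxm, ?_⟩
  · exact AnalyticAt.fun_comp (by rw [map_zero]; exact hΨ.analyticAt) (A.analyticAt 0)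
  · rw [map_zero, hΨ.map_zero]
  · have h1 : HasFDerivAt Ψ (fderiv ℂ Ψ 0) (A 0) := by
      rw [map_zero]; exact hΨ.analyticAt.differentiableAt.hasFDerivAt
    have h2 : HasFDerivAt (fun z => Ψ (A z)) _ 0 := h1.comp 0 A.hasFDerivAt
    rw [h2.fderiv]
    exact hΨ.bijective_fderiv.comp (shearSplit_bijective c)
  · have hfirst : Filter.Tendsto firstTwo (𝓝 0) (𝓝 0) := by
      have h1 : Continuous firstTwo := by unfold firstTwo; fun_prop
      exact h1.tendsto' 0 0 (by ext i; fin_cases i <;> rfl)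
    have h1 : (fun z => ((R (Ψ (A z)) - R (Ψ (T (firstTwo z), 0)) - (z 2).re : ℝ) : ℂ)) =O[𝓝 0]
        fun z => ‖z 2‖ * ‖z‖ + ‖firstTwo z‖ ^ (η + 1) := by
      refine Complex.isBigO_ofReal_left.2 (((hΨ.isBigO.comp_tendsto hAt).trans
        ((A.isBigO_id (𝓝 0)).norm_left.norm_right.mul (g₂ := fun z => ‖z 2‖)
          (Asymptotics.IsBigO.of_bound 1 (Filter.Eventually.of_forall fun z => ?_)))).trans
        (Asymptotics.IsBigO.of_bound 1 (Filter.Eventually.of_forall fun z => ?_))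
          |>.congr_left fun z => ?_)
      · simp [hA]
      · rw [one_mul, Real.norm_of_nonneg (by positivity), Real.norm_of_nonneg (by positivity),
          mul_comm]
        exact le_add_of_nonneg_right (by positivity)
      · simp only [Function.comp_apply, hA]
    have h2 : (fun z => (R (Ψ (T (firstTwo z), 0)) : ℂ) - jetSum η G (firstTwo z)) =O[𝓝 0]
        fun z => ‖z 2‖ * ‖z‖ + ‖firstTwo z‖ ^ (η + 1) := by
      refine (hG.isBigO.comp_tendsto hfirst).trans
        (Asymptotics.IsBigO.of_bound 1 (Filter.Eventually.of_forall fun z => ?_))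
      simp only [Function.comp_apply, norm_pow, norm_norm, one_mul]
      exact (le_add_of_nonneg_left (by positivity)).trans (Real.le_norm_self _)
    refine (h1.add h2).congr_left fun z => ?_
    rw [hsum]
    push_cast
    ring
  -- The shear is the identity where `z₂ = 0`, so the equation of `V` keeps the same `g`.
  · filter_upwards [hAt.eventually hgV] with z hz
    rw [hz, hA]
    have h1 : T (firstTwo z) 1 = z 1 := by simp [T, shear_apply, firstTwo]
    have h2 : T (firstTwo z) 0 = z 0 + c * z 1 := by simp [T, shear_apply, firstTwo]
    simp only [h1, h2]
    exact and_congr_right fun h => by rw [h, mul_zero, add_zero]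
  · refine hΨO.congr_left fun t => ?_
    simp only [hA]
    congr 2
    refine Prod.ext ?_ rfl
    simp [T, shear_apply, firstTwo]
  -- The shear sends `(0, 1)` to `(c, 1)`, where the chosen component is nonzero.
  · refine coefficient_ne_zero ha ?_
    rw [hGF x (by omega)]
    simpa [T, shear_apply] using hc
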